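/- **Setting.** Let $\tau:\mathbb R\to[0,\infty)$ and $p:\mathbb R\to\mathbb R$ be Lebesgue measurable and essentially bounded, and consider $$x''(t)+p(t)\,x(t-\tau(t))=0. \tag{1}$$ For $s\in\mathbb R$ put $\tau_m:=\operatorname{ess\,sup}\{\tau(t):t\ge s\}$. A solution of (1) is a function $x:[s-\tau_m,\infty)\to\mathbb R$ that is (locally) absolutely continuous together with its first derivative and satisfies (1) almost everywhere on $[s,\infty)$. It is oscillatory if it has arbitrarily large zeros. **The function $\Psi$.** For $\Delta\ge 0$ let $r_\Delta$ be the solution of $r_\Delta''(t)+r_\Delta(t-\Delta)=0$ for $t\ge0$, with $r_\Delta(t)=1$ for $t\le 0$ and $r_\Delta'(0)=0$; explicitly, for $t\ge 0$, $$r_\Delta(t)=1+\sum_{k\ge1}\frac{(-1)^k}{(2k)!}\,\max\{t-(k-1)\Delta,0\}^{2k}.$$ Let $\vartheta_\Delta$ be its first zero. For $\rho>0$ define functions $\beta_n$ on $(-\infty,0]$ and numbers $\varpi_n>0$ as follows: $\beta_0\equiv1$; given $\beta_n$, put $$g_n(v)=\max\{\beta_n(v),\ \rho\, r_\Delta(\vartheta_\Delta-v-\Delta)\,\chi_{[-\Delta,0]}(v)\},$$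 let $\varpi_n>0$ be the unique number with $$\int_{-\varpi_n}^0\int_{-\varpi_n}^s g_n(w)\,dw\,ds=1,$$ and put $\beta_{n+1}(t)=1$ for $t\le-\varpi_n$ and $$\beta_{n+1}(t)=1-\int_{-\varpi_n}^t\int_{-\varpi_n}^s g_n(v)\,dv\,ds\qquad\text{for } t\in[-\varpi_n,0].$$ Let $\Psi(\rho,\Delta):=\lim_{n\to\infty}\varpi_n$. **Theorem 3.14.** There is exactly one $\gamma\in[\sqrt2,\pi/2]$ with $\Psi(1,\gamma)=\gamma$. Let $p(t)\le0$ for all $t\in\mathbb R$, and let $x$ be an oscillatory solution of (1), defined on $[s-\tau_m,\infty)$. If $$\tau_m\sqrt{\operatorname{ess\,sup}_{t\in\mathbb R}|p(t)|}\le\gamma,$$ then $x$ is bounded. If the strict inequality holds, then $x(t)\to0$ as $t\to\infty$. -/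

import Mathlib

open Set Filter Topology MeasureTheory

noncomputable section

namespace DelayEq

/-! ### The descent from a maximum to a zero -/

/-- `r = r_Δ` solves the initial value problem `r''(t) + r(t - Δ) = 0` for `t ≥ 0`, `r(t) = 1` for
`t ≤ 0`, `r'(0) = 0` (the second derivative at `t = 0` is the right one). The last condition is
implied by the other ones, as `r` is differentiable at `0`. -/
structure IsDescentSol (Δ : ℝ) (r : ℝ → ℝ) : Prop where
  init : ∀ t ≤ 0, r t = 1
  eqn : ∃ r' : ℝ → ℝ, (∀ t, HasDerivAt r (r' t) t) ∧ r' 0 = 0 ∧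
    ∀ t ≥ 0, HasDerivWithinAt r' (-r (t - Δ)) (Ici 0) t

/-- The `k`-th term of the series of `r_Δ`: `(-1)^k / (2k)! * [t - (k-1)Δ]^(2k)`, present only from
the time `t = (k-1)Δ` on (the term `k = 0` is the constant `1`). -/
def descentTerm (Δ : ℝ) (k : ℕ) (t : ℝ) : ℝ :=
  (-1) ^ k / (Nat.factorial (2 * k) : ℝ) * max (t - ((k : ℝ) - 1) * Δ) 0 ^ (2 * k)

/-- The function `r_Δ`. For `Δ > 0` and `t ∈ [(n-1)Δ, nΔ]` it is
`∑_{k=0}^{n} (-1)^k / (2k)! * [t - (k-1)Δ]^(2k)`, and for `Δ = 0` and `t ≥ 0` it is `cos t`.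
That it is the solution of the defining initial value problem is `isDescentSol_descentSol`. -/
def descentSol (Δ t : ℝ) : ℝ := ∑' k : ℕ, descentTerm Δ k t

/-- `ϑ_Δ`, the first zero of `r_Δ`. -/
def descentZero (Δ : ℝ) : ℝ := sInf {t : ℝ | 0 ≤ t ∧ descentSol Δ t = 0}

/-! ### The ascent from a zero to a maximum (in reversed time) -/

/-- `max {β(v), ρ r_Δ(ϑ_Δ - v - Δ) χ_{[-Δ,0]}(v)}`. -/
def ascentForcing (ρ Δ : ℝ) (β : ℝ → ℝ) (v : ℝ) : ℝ :=
  max (β v)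
    (ρ * (Icc (-Δ) 0).indicator (fun u => descentSol Δ (descentZero Δ - u - Δ)) v)

/-- `h(v) = ∫_v^0 ∫_v^s max {β(w), ρ r_Δ(ϑ_Δ - w - Δ) χ_{[-Δ,0]}(w)} dw ds`, for `v ≤ 0`. -/
def ascentHeight (ρ Δ : ℝ) (β : ℝ → ℝ) (v : ℝ) : ℝ :=
  ∫ s in v..0, ∫ w in v..s, ascentForcing ρ Δ β w

/-- The number `ϖ > 0` with `h(-ϖ) = 1` (there is exactly one for the functions `β = β_n`). -/
def ascentTime (ρ Δ : ℝ) (β : ℝ → ℝ) : ℝ :=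
  sInf {ω : ℝ | 0 < ω ∧ ascentHeight ρ Δ β (-ω) = 1}

/-- The functions `β_n` on `(-∞, 0]`: `β_0 = 1`, and `β_{n+1}` is `1` on `(-∞, -ϖ_n]` and
`1 - ∫_{-ϖ_n}^t ∫_{-ϖ_n}^s max {β_n(v), ρ r_Δ(ϑ_Δ - v - Δ) χ_{[-Δ,0]}(v)} dv ds` on `[-ϖ_n, 0]`
(the values at positive `t` are never used). -/
def ascentSeq (ρ Δ : ℝ) : ℕ → ℝ → ℝ
  | 0 => fun _ => 1
  | n + 1 => fun t =>
    if t ≤ -ascentTime ρ Δ (ascentSeq ρ Δ n) then 1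
    else 1 - ∫ s in (-ascentTime ρ Δ (ascentSeq ρ Δ n))..t,
      ∫ v in (-ascentTime ρ Δ (ascentSeq ρ Δ n))..s, ascentForcing ρ Δ (ascentSeq ρ Δ n) v

/-- `Ψ(ρ, Δ) = lim ϖ_n`. -/
def Psi (ρ Δ : ℝ) : ℝ := limUnder atTop fun n : ℕ => ascentTime ρ Δ (ascentSeq ρ Δ n)

/-! ### The delay equation -/

/-- A measurable and essentially bounded function on the line. -/
def IsEssBdd (f : ℝ → ℝ) : Prop :=
  AEMeasurable f volume ∧ ∃ C : ℝ, ∀ᵐ t ∂volume, |f t| ≤ C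

/-- `τ_m = ess sup {τ(t) : t ≥ s}`. -/
def maxDelay (τ : ℝ → ℝ) (s : ℝ) : ℝ := essSup τ (volume.restrict (Ici s))

/-- `x`, restricted to `[s - τ_m, ∞)`, is a solution of `x''(t) + p(t) x(t - τ(t)) = 0`: it is
differentiable, `x` and `x'` are absolutely continuous (on compact subintervals), and the equation
holds almost everywhere on `[s, ∞)`. -/
def IsSolution (p τ : ℝ → ℝ) (s : ℝ) (x : ℝ → ℝ) : Prop :=
  ∃ x' : ℝ → ℝ,
    (∀ t ≥ s - maxDelay τ s, HasDerivWithinAt x (x' t) (Ici (s - maxDelay τ s)) t) ∧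
    (∀ T ≥ s - maxDelay τ s, AbsolutelyContinuousOnInterval x (s - maxDelay τ s) T ∧
      AbsolutelyContinuousOnInterval x' (s - maxDelay τ s) T) ∧
    ∀ᵐ t ∂(volume.restrict (Ici s)), ∃ x'' : ℝ, HasDerivAt x' x'' t ∧ x'' + p t * x (t - τ t) = 0

/-- `x` has arbitrarily large zeros. -/
def IsOscillatory (x : ℝ → ℝ) : Prop := ∀ T : ℝ, ∃ t > T, x t = 0

/-! ### `r_Δ` solves its initial value problem -/

theorem hasDerivAt_posPart_pow (c t : ℝ) (m : ℕ) (hm : 1 ≤ m) :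
    HasDerivAt (fun y : ℝ => max (y - c) 0 ^ (m + 1)) ((m + 1 : ℝ) * max (t - c) 0 ^ m) t := by
  rcases lt_trichotomy t c with h | h | h
  · have h1 : (fun y : ℝ => max (y - c) 0 ^ (m + 1)) =ᶠ[𝓝 t] fun _ => 0 := by
      filter_upwards [Iio_mem_nhds h] with y hy
      rw [max_eq_right (by linarith [mem_Iio.1 hy])]; simp
    have h2 : max (t - c) 0 = 0 := max_eq_right (by linarith)
    rw [h2, zero_pow (by omega), mul_zero]
    exact (hasDerivAt_const t (0 : ℝ)).congr_of_eventuallyEq h1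
  · subst h
    have h2 : max (t - t) 0 = 0 := by simp
    rw [h2, zero_pow (by omega), mul_zero, hasDerivAt_iff_isLittleO_nhds_zero]
    simp only [add_sub_cancel_left, sub_self, max_self, smul_zero, sub_zero,
      zero_pow (Nat.succ_ne_zero m)]
    have h3 : (fun y : ℝ => max y 0 ^ (m + 1)) =O[𝓝 0] fun y : ℝ => y ^ (m + 1) := by
      refine Asymptotics.isBigO_of_le _ fun y => ?_
      rw [norm_pow, norm_pow]
      refine pow_le_pow_left₀ (norm_nonneg _) ?_ _
      rw [Real.norm_eq_abs, Real.norm_eq_abs, abs_of_nonneg (le_max_right _ _)]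
      exact max_le (le_abs_self _) (abs_nonneg _)
    exact h3.trans_isLittleO (by
      simpa using (Asymptotics.isLittleO_pow_pow (𝕜 := ℝ) (m := 1) (n := m + 1) (by omega)))
  · have h1 : (fun y : ℝ => max (y - c) 0 ^ (m + 1)) =ᶠ[𝓝 t] fun y => (y - c) ^ (m + 1) := by
      filter_upwards [Ioi_mem_nhds h] with y hy
      rw [max_eq_left (by linarith [mem_Ioi.1 hy])]
    rw [max_eq_left (by linarith : (0 : ℝ) ≤ t - c)]
    have := ((hasDerivAt_id t).sub_const c).pow (m + 1)
    simp only [id, mul_one, Nat.add_sub_cancel] at this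
    push_cast at this
    exact this.congr_of_eventuallyEq h1

/-- The derivative of the `k`-th term. -/
def descentTerm' (Δ : ℝ) (k : ℕ) (t : ℝ) : ℝ :=
  if k = 0 then 0 else
    (-1) ^ k / (Nat.factorial (2 * k - 1) : ℝ) * max (t - ((k : ℝ) - 1) * Δ) 0 ^ (2 * k - 1)

theorem hasDerivAt_descentTerm (Δ : ℝ) (k : ℕ) (t : ℝ) :
    HasDerivAt (descentTerm Δ k) (descentTerm' Δ k t) t := by
  rcases k with _ | j
  · have : descentTerm Δ 0 = fun _ => 1 := by funext y; simp [descentTerm]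
    rw [this]; simpa [descentTerm'] using hasDerivAt_const t (1 : ℝ)
  · have h := (hasDerivAt_posPart_pow ((((j + 1 : ℕ) : ℝ) - 1) * Δ) t (2 * j + 1)
      (by omega)).const_mul ((-1 : ℝ) ^ (j + 1) / (Nat.factorial (2 * (j + 1)) : ℝ))
    refine h.congr_deriv ?_
    have e1 : 2 * (j + 1) = (2 * j + 1) + 1 := by ring
    have e2 : 2 * (j + 1) - 1 = 2 * j + 1 := by omega
    rw [descentTerm', if_neg (Nat.succ_ne_zero j), e2, e1, Nat.factorial_succ (2 * j + 1)]
    have h1 : (Nat.factorial (2 * j + 1) : ℝ) ≠ 0 := by positivity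
    push_cast
    field_simp

theorem summable_even (R : ℝ) :
    Summable fun k : ℕ => R ^ (2 * k) / (Nat.factorial (2 * k) : ℝ) :=
  (Real.summable_pow_div_factorial R).comp_injective
    (i := fun k : ℕ => 2 * k) (fun a b h => by simpa using h)

theorem summable_odd (R : ℝ) :
    Summable fun k : ℕ => R ^ (2 * k - 1) / (Nat.factorial (2 * k - 1) : ℝ) := by
  rw [← summable_nat_add_iff 1]
  exact (Real.summable_pow_div_factorial R).comp_injective
    (i := fun k : ℕ => 2 * (k + 1) - 1) (fun a b h => by simp only at h; omega)

theorem posPart_le {Δ R t : ℝ} (hΔ : 0 ≤ Δ) (hR : 0 ≤ R) (ht : t ≤ R) (k : ℕ) (hk : k ≠ 0) :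
    max (t - ((k : ℝ) - 1) * Δ) 0 ≤ R := by
  have h1 : (1 : ℝ) ≤ k := by exact_mod_cast Nat.one_le_iff_ne_zero.2 hk
  have h2 : 0 ≤ ((k : ℝ) - 1) * Δ := mul_nonneg (by linarith) hΔ
  exact max_le (by linarith) hR

theorem norm_descentTerm_le {Δ R t : ℝ} (hΔ : 0 ≤ Δ) (hR : 0 ≤ R) (ht : t ≤ R) (k : ℕ) :
    ‖descentTerm Δ k t‖ ≤ R ^ (2 * k) / (Nat.factorial (2 * k) : ℝ) := by
  rcases eq_or_ne k 0 with rfl | hk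
  · simp [descentTerm]
  · rw [descentTerm, norm_mul, norm_div, norm_pow, norm_neg, norm_one, one_pow, norm_pow,
      Real.norm_natCast, Real.norm_eq_abs, abs_of_nonneg (le_max_right _ _),
      one_div, inv_mul_eq_div]
    gcongr
    exact posPart_le hΔ hR ht k hk

theorem norm_descentTerm'_le {Δ R t : ℝ} (hΔ : 0 ≤ Δ) (hR : 0 ≤ R) (ht : t ≤ R) (k : ℕ) :
    ‖descentTerm' Δ k t‖ ≤ R ^ (2 * k - 1) / (Nat.factorial (2 * k - 1) : ℝ) := by
  rcases eq_or_ne k 0 with rfl | hk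
  · simp [descentTerm']
  · rw [descentTerm', if_neg hk, norm_mul, norm_div, norm_pow, norm_neg, norm_one, one_pow,
      norm_pow, Real.norm_natCast, Real.norm_eq_abs, abs_of_nonneg (le_max_right _ _),
      one_div, inv_mul_eq_div]
    gcongr
    exact posPart_le hΔ hR ht k hk

theorem summable_descentTerm {Δ : ℝ} (hΔ : 0 ≤ Δ) (t : ℝ) :
    Summable fun k => descentTerm Δ k t :=
  .of_norm_bounded (summable_even |t|)
    fun k => norm_descentTerm_le hΔ (abs_nonneg t) (le_abs_self t) k

theorem summable_descentTerm' {Δ : ℝ} (hΔ : 0 ≤ Δ) (t : ℝ) :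
    Summable fun k => descentTerm' Δ k t :=
  .of_norm_bounded (summable_odd |t|)
    fun k => norm_descentTerm'_le hΔ (abs_nonneg t) (le_abs_self t) k

theorem hasDerivAt_descentSol {Δ : ℝ} (hΔ : 0 ≤ Δ) (t : ℝ) :
    HasDerivAt (descentSol Δ) (∑' k, descentTerm' Δ k t) t :=
  hasDerivAt_tsum_of_isPreconnected (summable_odd (|t| + 1)) (t := Iio (|t| + 1)) isOpen_Iio
    isPreconnected_Iio (fun k y _ => hasDerivAt_descentTerm Δ k y)
    (fun k y hy => norm_descentTerm'_le hΔ (by positivity) (le_of_lt hy) k)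
    (y₀ := t) (by simp only [mem_Iio]; linarith [le_abs_self t]) (summable_descentTerm hΔ t)
    (by simp only [mem_Iio]; linarith [le_abs_self t])

/-- Up to the term `-max(t, 0)`, the derivative of `r_Δ` is a series that can be differentiated
term by term. -/
theorem tsum_descentTerm'_eq {Δ : ℝ} (hΔ : 0 ≤ Δ) (t : ℝ) :
    ∑' k, descentTerm' Δ k t = -max t 0 + ∑' k, descentTerm' Δ (k + 2) t := by
  rw [← (summable_descentTerm' hΔ t).sum_add_tsum_nat_add 2]
  simp [Finset.sum_range_succ, descentTerm']

theorem hasDerivAt_descentTerm'_add_two (Δ : ℝ) (k : ℕ) (t : ℝ) :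
    HasDerivAt (descentTerm' Δ (k + 2)) (-descentTerm Δ (k + 1) (t - Δ)) t := by
  have h := (hasDerivAt_posPart_pow ((((k + 2 : ℕ) : ℝ) - 1) * Δ) t (2 * k + 2)
    (by omega)).const_mul ((-1 : ℝ) ^ (k + 2) / (Nat.factorial (2 * k + 3) : ℝ))
  have e0 : descentTerm' Δ (k + 2) = fun y => (-1 : ℝ) ^ (k + 2) / (Nat.factorial (2 * k + 3) : ℝ) *
      max (y - (((k + 2 : ℕ) : ℝ) - 1) * Δ) 0 ^ (2 * k + 2 + 1) := by
    funext y
    have e : 2 * (k + 2) - 1 = 2 * k + 3 := by omega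
    rw [descentTerm', if_neg (by omega), e]
  rw [e0]
  refine h.congr_deriv ?_
  have e1 : 2 * (k + 1) = 2 * k + 2 := by ring
  have e2 : t - Δ - (((k + 1 : ℕ) : ℝ) - 1) * Δ = t - (((k + 2 : ℕ) : ℝ) - 1) * Δ := by
    push_cast; ring
  rw [descentTerm, e1, e2, Nat.factorial_succ (2 * k + 2)]
  have h1 : (Nat.factorial (2 * k + 2) : ℝ) ≠ 0 := by positivity
  push_cast
  field_simp
  ring

theorem hasDerivAt_tsum_descentTerm' {Δ : ℝ} (hΔ : 0 ≤ Δ) (t : ℝ) :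
    HasDerivAt (fun y => ∑' k, descentTerm' Δ (k + 2) y)
      (∑' k, -descentTerm Δ (k + 1) (t - Δ)) t := by
  have hlt : t ∈ Iio (|t| + 1) := by simp only [mem_Iio]; linarith [le_abs_self t]
  have hu : Summable fun k : ℕ =>
      (|t| + 1) ^ (2 * (k + 1)) / (Nat.factorial (2 * (k + 1)) : ℝ) :=
    (summable_nat_add_iff (f := fun k : ℕ => (|t| + 1) ^ (2 * k) / (Nat.factorial (2 * k) : ℝ)) 1).2
      (summable_even (|t| + 1))
  have h0 : Summable fun k : ℕ => descentTerm' Δ (k + 2) t :=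
    (summable_nat_add_iff (f := fun k : ℕ => descentTerm' Δ k t) 2).2 (summable_descentTerm' hΔ t)
  have hb : ∀ (k : ℕ) (y : ℝ), y ∈ Iio (|t| + 1) → ‖-descentTerm Δ (k + 1) (y - Δ)‖ ≤
      (|t| + 1) ^ (2 * (k + 1)) / (Nat.factorial (2 * (k + 1)) : ℝ) := by
    intro k y hy
    rw [norm_neg]
    exact norm_descentTerm_le hΔ (by positivity) (by linarith [mem_Iio.1 hy]) (k + 1)
  exact hasDerivAt_tsum_of_isPreconnected (g := fun k => descentTerm' Δ (k + 2))
    (g' := fun k y => -descentTerm Δ (k + 1) (y - Δ)) hu isOpen_Iio isPreconnected_Iio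
    (fun k y _ => hasDerivAt_descentTerm'_add_two Δ k y) hb hlt h0 hlt

theorem descentSol_eq_one {Δ t : ℝ} (hΔ : 0 ≤ Δ) (ht : t ≤ 0) : descentSol Δ t = 1 := by
  rw [descentSol, tsum_eq_single 0]
  · simp [descentTerm]
  · intro k hk
    have h := posPart_le hΔ le_rfl ht k hk
    have h' : max (t - ((k : ℝ) - 1) * Δ) 0 = 0 := le_antisymm h (le_max_right _ _)
    rw [descentTerm, h', zero_pow (by omega), mul_zero]

theorem isDescentSol_descentSol {Δ : ℝ} (hΔ : 0 ≤ Δ) : IsDescentSol Δ (descentSol Δ) := by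
  refine ⟨fun t ht => descentSol_eq_one hΔ ht, fun t => ∑' k, descentTerm' Δ k t,
    hasDerivAt_descentSol hΔ, ?_, ?_⟩
  · have h : ∀ k, descentTerm' Δ k 0 = 0 := by
      intro k
      rcases eq_or_ne k 0 with rfl | hk
      · simp [descentTerm']
      · have h' : max ((0 : ℝ) - ((k : ℝ) - 1) * Δ) 0 = 0 :=
          le_antisymm (posPart_le hΔ le_rfl le_rfl k hk) (le_max_right _ _)
        rw [descentTerm', if_neg hk, h', zero_pow (by omega), mul_zero]
    simp [h]
  · intro t ht
    have h1 := hasDerivAt_tsum_descentTerm' hΔ t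
    have h2 : HasDerivWithinAt (fun y : ℝ => -max y 0) (-1) (Ici 0) t :=
      ((hasDerivAt_id t).neg.hasDerivWithinAt).congr
        (fun y hy => by simp [max_eq_left (mem_Ici.1 hy)]) (by simp [max_eq_left ht])
    have h3 := h2.add h1.hasDerivWithinAt
    have e : -descentSol Δ (t - Δ) = -1 + ∑' k, -descentTerm Δ (k + 1) (t - Δ) := by
      rw [descentSol, (summable_descentTerm hΔ (t - Δ)).tsum_eq_zero_add, tsum_neg]
      simp [descentTerm]
      ring
    rw [e]
    exact h3.congr (fun y _ => tsum_descentTerm'_eq hΔ y) (tsum_descentTerm'_eq hΔ t)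

end DelayEq

end

/-!
As `p ≤ 0`, the function `|x|` is concave while the delayed value has the opposite sign of `x`, and
convex while it has the same sign. Measure time in units of `1 / √(ess sup |p|)`, so that
the coefficient is at most `1` and the delay at most `D ≤ γ`. Between two zeros, `|x|` takes its
maximum at most `D` after the preceding zero, because later all delayed values have the sign of `x`
and `x` is convex (`IsDelayEvolution.exists_peak`). On the other hand the ascent from a zero to a
maximum is slow: if `|x| ≤ 1`, then `|x|` is bounded by the descent solution before the zero
(`IsDelayEvolution.abs_le_delayProfile`) and by `β_n` after it
(`IsDelayEvolution.abs_le_riseSeq_succ`), so that the value `1` is not reached before the time `ϖ_n`,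
and `ϖ_n → Ψ(1, γ) = γ`. For `D < γ` this gives a factor below `1`, from one bound for the tail of
`|x|` to the next (`IsDelayEvolution.eventually_le_mul`). For `D = γ` a new strict record of `|x|`
would have to be reached in a time of exactly `γ`; but if the record is normalized to `1`, the values
before the zero stay below some `ρ < 1`, and this missing part of the forcing makes it impossible
(`IsDelayEvolution.record_false`).

The recursion for `β_n` is studied in the variable `a`, the time after the zero. There `β_{n+1}` is
the integral of `g_n` against the Green function `min a w` (`rise`), an operator that is monotone
(`riseTime_anti`, `rise_le_rise`) and has a quarter sine wave as its fixed point without delayed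
forcing. For `Δ ∈ [√2, π/2]` one has `ϑ_Δ = √2` and the delayed forcing is an explicit quadratic,
which increases with `Δ`. Hence `Ψ(1, ·)` is nonincreasing, which leaves room for at most one fixed
point. In the time `u` to the maximum, the forcing at a fixed point is `max {cos u, 1 - [√2 - u]²/2}`
regardless of `γ`, and `γ` is the time after which the solution with this forcing has descended from
`1` to `0` (`exists_firstMoment_fixForcing`). To see that the iteration indeed converges to this
fixed point, its distance to the fixed point is estimated by the linear Green operator on `[0, γ]`,
which contracts its first eigenfunction because `γ < π/2` (`riseSeq_sub_le`, `Psi_fix`).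
-/

noncomputable section

namespace DelayEq

/-! ### The ascent operator -/

/-- The first moment `∫₀^ω w g(w) dw`: the height gained in time `ω` by a function that starts with
velocity zero at its maximum and whose second derivative is `-g`, with `w` the time to the zero. -/
def firstMoment (g : ℝ → ℝ) (ω : ℝ) : ℝ := ∫ w in (0 : ℝ)..ω, w * g w

/-- The time at which the first moment of `g` reaches `1`. -/
def riseTime (g : ℝ → ℝ) : ℝ := sInf {ω : ℝ | 0 < ω ∧ firstMoment g ω = 1}

/-- The function `b` on `[0, ∞)` with `b(0) = 0`, `b'' = -g` on `[0, ϖ]`, and `b = 1` from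
`ϖ = riseTime g` on, written with the Green function `min a w` of this boundary value problem. -/
def rise (g : ℝ → ℝ) (a : ℝ) : ℝ := ∫ w in (0 : ℝ)..riseTime g, min a w * g w

/-- The forcings to which the ascent operator is applied: continuous, at most `1`, and at least the
quarter sine wave that ends in the constant `1`, which is the fixed point without delayed forcing.
Only arguments in `[0, ∞)` matter. -/
structure Admissible (g : ℝ → ℝ) : Prop where
  cont : Continuous g
  sin_le : ∀ a, 0 ≤ a → Real.sin (min a (Real.pi / 2)) ≤ g a
  le_one : ∀ a, 0 ≤ a → g a ≤ 1

theorem sin_min_nonneg {a : ℝ} (ha : 0 ≤ a) : 0 ≤ Real.sin (min a (Real.pi / 2)) :=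
  Real.sin_nonneg_of_nonneg_of_le_pi (le_min ha (by positivity))
    ((min_le_right _ _).trans (by linarith [Real.pi_pos]))

theorem sin_min_pos {a : ℝ} (ha : 0 < a) : 0 < Real.sin (min a (Real.pi / 2)) :=
  Real.sin_pos_of_pos_of_lt_pi (lt_min ha (by positivity))
    ((min_le_right _ _).trans_lt (by linarith [Real.pi_pos]))

theorem hasDerivAt_firstMoment {g : ℝ → ℝ} (hg : Continuous g) (ω : ℝ) :
    HasDerivAt (firstMoment g) (ω * g ω) ω :=
  (Continuous.integral_hasStrictDerivAt (f := fun w => w * g w) (by fun_prop) 0 ω).hasDerivAt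

theorem firstMoment_sub {g : ℝ → ℝ} (hg : Continuous g) (a b : ℝ) :
    firstMoment g b - firstMoment g a = ∫ w in a..b, w * g w := by
  have hc : Continuous fun w => w * g w := by fun_prop
  rw [firstMoment, firstMoment,
    intervalIntegral.integral_interval_sub_left (hc.intervalIntegrable _ _)
      (hc.intervalIntegrable _ _)]

theorem firstMoment_sin :
    firstMoment (fun a => Real.sin (min a (Real.pi / 2))) (Real.pi / 2) = 1 := by
  have h0 : (0 : ℝ) ≤ Real.pi / 2 := by positivity
  have h1 : firstMoment (fun a => Real.sin (min a (Real.pi / 2))) (Real.pi / 2)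
      = ∫ w in (0 : ℝ)..Real.pi / 2, w * Real.sin w := by
    refine intervalIntegral.integral_congr fun w hw => ?_
    rw [uIcc_of_le h0] at hw
    simp [min_eq_left hw.2]
  rw [h1, intervalIntegral.integral_eq_sub_of_hasDerivAt
    (f := fun w => Real.sin w - w * Real.cos w)]
  · simp
  · intro w _
    have := (Real.hasDerivAt_sin w).sub ((hasDerivAt_id w).mul (Real.hasDerivAt_cos w))
    refine this.congr_deriv ?_
    simp
  · exact Continuous.intervalIntegrable (by fun_prop) _ _

namespace Admissible

variable {g : ℝ → ℝ} (hg : Admissible g)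
include hg

theorem pos {a : ℝ} (ha : 0 < a) : 0 < g a := (sin_min_pos ha).trans_le (hg.sin_le a ha.le)

theorem nonneg {a : ℝ} (ha : 0 ≤ a) : 0 ≤ g a := (sin_min_nonneg ha).trans (hg.sin_le a ha)

theorem firstMoment_strictMonoOn : StrictMonoOn (firstMoment g) (Ici 0) := by
  refine strictMonoOn_of_deriv_pos (convex_Ici 0)
    (fun x _ => (hasDerivAt_firstMoment hg.cont x).continuousAt.continuousWithinAt) fun x hx => ?_
  rw [interior_Ici] at hx
  rw [(hasDerivAt_firstMoment hg.cont x).deriv]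
  exact mul_pos hx (hg.pos hx)

theorem firstMoment_le {ω : ℝ} (hω : 0 ≤ ω) : firstMoment g ω ≤ ω ^ 2 / 2 := by
  have h : ∫ w in (0 : ℝ)..ω, w = ω ^ 2 / 2 := by simp
  rw [← h]
  have hc := hg.cont
  refine intervalIntegral.integral_mono_on hω (Continuous.intervalIntegrable (by fun_prop) _ _)
    (Continuous.intervalIntegrable (by fun_prop) _ _) fun w hw => ?_
  exact mul_le_of_le_one_right hw.1 (hg.le_one w hw.1)

theorem one_le_firstMoment : 1 ≤ firstMoment g (Real.pi / 2) := by
  rw [← firstMoment_sin]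
  have hc := hg.cont
  refine intervalIntegral.integral_mono_on (by positivity)
    (Continuous.intervalIntegrable (by fun_prop) _ _)
    (Continuous.intervalIntegrable (by fun_prop) _ _) fun w hw => ?_
  exact mul_le_mul_of_nonneg_left (hg.sin_le w hw.1) hw.1

theorem riseTime_eq {ω : ℝ} (hω : 0 < ω) (h : firstMoment g ω = 1) : riseTime g = ω := by
  have : {ω : ℝ | 0 < ω ∧ firstMoment g ω = 1} = {ω} := by
    ext y
    simp only [mem_ofPred_eq, mem_singleton_iff]
    refine ⟨fun hy => hg.firstMoment_strictMonoOn.injOn hy.1.le hω.le (hy.2.trans h.symm), ?_⟩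
    rintro rfl
    exact ⟨hω, h⟩
  rw [riseTime, this, csInf_singleton]

theorem riseTime_spec : riseTime g ∈ Icc (√2) (Real.pi / 2) ∧ firstMoment g (riseTime g) = 1 := by
  have h2 : (√2 : ℝ) ≤ Real.pi / 2 := by
    rw [Real.sqrt_le_left (by positivity)]
    nlinarith [Real.pi_gt_three]
  have h := intermediate_value_Icc h2 (f := firstMoment g)
    (fun x _ => (hasDerivAt_firstMoment hg.cont x).continuousAt.continuousWithinAt)
  obtain ⟨ω, hω, h1⟩ := h ⟨(hg.firstMoment_le (Real.sqrt_nonneg 2)).trans (by simp),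
    hg.one_le_firstMoment⟩
  have hpos : 0 < ω := lt_of_lt_of_le (by positivity) hω.1
  rw [hg.riseTime_eq hpos h1]
  exact ⟨hω, h1⟩

theorem riseTime_pos : 0 < riseTime g := lt_of_lt_of_le (by positivity) hg.riseTime_spec.1.1

theorem rise_of_le {a : ℝ} (ha : riseTime g ≤ a) : rise g a = 1 := by
  rw [← hg.riseTime_spec.2]
  refine intervalIntegral.integral_congr fun w hw => ?_
  rw [uIcc_of_le hg.riseTime_pos.le] at hw
  simp [min_eq_right (hw.2.trans ha)]

theorem rise_mono {a b : ℝ} (hab : a ≤ b) : rise g a ≤ rise g b := by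
  have hc := hg.cont
  refine intervalIntegral.integral_mono_on hg.riseTime_pos.le
    (Continuous.intervalIntegrable (by fun_prop) _ _)
    (Continuous.intervalIntegrable (by fun_prop) _ _) fun w hw => ?_
  exact mul_le_mul_of_nonneg_right (min_le_min_right _ hab) (hg.nonneg hw.1)

theorem rise_le_one (a : ℝ) : rise g a ≤ 1 := by
  rw [← hg.rise_of_le (le_max_right a (riseTime g))]
  exact hg.rise_mono (le_max_left _ _)

theorem rise_zero : rise g 0 = 0 := by
  have : ∫ w in (0 : ℝ)..riseTime g, min 0 w * g w = ∫ w in (0 : ℝ)..riseTime g, (0 : ℝ) := by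
    refine intervalIntegral.integral_congr fun w hw => ?_
    rw [uIcc_of_le hg.riseTime_pos.le] at hw
    simp [min_eq_left hw.1]
  rw [rise, this]
  simp

theorem continuous_rise : Continuous (rise g) := by
  have hc := hg.cont
  refine intervalIntegral.continuous_parametric_intervalIntegral_of_continuous' ?_ _ _
  simp only [Function.uncurry_def]
  fun_prop

theorem rise_le_two_mul {a : ℝ} (ha : 0 ≤ a) : rise g a ≤ 2 * a := by
  have hc := hg.cont
  have h1 : rise g a ≤ ∫ _ in (0 : ℝ)..riseTime g, a := by
    refine intervalIntegral.integral_mono_on hg.riseTime_pos.le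
      (Continuous.intervalIntegrable (by fun_prop) _ _)
      (Continuous.intervalIntegrable (by fun_prop) _ _) fun w hw => ?_
    exact (mul_le_of_le_one_right (le_min ha hw.1) (hg.le_one w hw.1)).trans (min_le_left _ _)
  have h2 : riseTime g ≤ 2 := hg.riseTime_spec.1.2.trans (by linarith [Real.pi_le_four])
  refine h1.trans ?_
  simp only [intervalIntegral.integral_const, smul_eq_mul, sub_zero]
  exact mul_le_mul_of_nonneg_right h2 ha

omit hg in
/-- Splitting the Green function `min a w` at the diagonal. -/
theorem integral_min_mul (hc : Continuous g) {a T : ℝ} (ha : 0 ≤ a) (haT : a ≤ T) :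
    ∫ w in (0 : ℝ)..T, min a w * g w = firstMoment g a + a * ∫ w in a..T, g w := by
  rw [← intervalIntegral.integral_add_adjacent_intervals (b := a)
    (Continuous.intervalIntegrable (by fun_prop) _ _)
    (Continuous.intervalIntegrable (by fun_prop) _ _), ← intervalIntegral.integral_const_mul]
  congr 1
  · refine intervalIntegral.integral_congr fun w hw => ?_
    rw [uIcc_of_le ha] at hw
    simp [min_eq_right hw.2]
  · refine intervalIntegral.integral_congr fun w hw => ?_
    rw [uIcc_of_le haT] at hw
    simp [min_eq_left hw.1]

theorem rise_eq {a : ℝ} (ha : 0 ≤ a) (haT : a ≤ riseTime g) :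
    rise g a = firstMoment g a + a * ∫ w in a..riseTime g, g w :=
  integral_min_mul hg.cont ha haT

theorem rise_eq_one_sub {a : ℝ} (ha : 0 ≤ a) (haT : a ≤ riseTime g) :
    rise g a = 1 - ∫ w in a..riseTime g, (w - a) * g w := by
  have hc := hg.cont
  have h := firstMoment_sub hg.cont a (riseTime g)
  rw [hg.riseTime_spec.2] at h
  rw [hg.rise_eq ha haT]
  have e : ∫ w in a..riseTime g, (w - a) * g w
      = (∫ w in a..riseTime g, w * g w) - a * ∫ w in a..riseTime g, g w := by
    rw [← intervalIntegral.integral_const_mul, ← intervalIntegral.integral_sub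
      (Continuous.intervalIntegrable (by fun_prop) _ _)
      (Continuous.intervalIntegrable (by fun_prop) _ _)]
    exact intervalIntegral.integral_congr fun w _ => by ring
  rw [e]
  linarith

theorem hasDerivAt_rise {a : ℝ} (ha : a ∈ Ioo 0 (riseTime g)) :
    HasDerivAt (rise g) (∫ w in a..riseTime g, g w) a := by
  have h1 : HasDerivAt (fun y => ∫ w in y..riseTime g, g w) (-g a) a := by
    have := ((Continuous.integral_hasStrictDerivAt hg.cont (riseTime g) a).hasDerivAt).neg
    refine this.congr_of_eventuallyEq (Eventually.of_forall fun y => ?_)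
    exact intervalIntegral.integral_symm _ _
  have h2 := (hasDerivAt_firstMoment hg.cont a).add ((hasDerivAt_id a).mul h1)
  refine (h2.congr_deriv ?_).congr_of_eventuallyEq ?_
  · simp
  · filter_upwards [Ioo_mem_nhds ha.1 ha.2] with y hy
    exact hg.rise_eq hy.1.le hy.2.le

end Admissible

/-- Monotonicity of the ascent operator: less forcing takes longer. -/
theorem riseTime_anti {g₁ g₂ : ℝ → ℝ} (h₁ : Admissible g₁) (h₂ : Admissible g₂)
    (h : ∀ a, 0 ≤ a → g₁ a ≤ g₂ a) : riseTime g₂ ≤ riseTime g₁ := by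
  rw [← h₁.firstMoment_strictMonoOn.le_iff_le h₂.riseTime_pos.le h₁.riseTime_pos.le,
    h₁.riseTime_spec.2, ← h₂.riseTime_spec.2]
  have hc₁ := h₁.cont
  have hc₂ := h₂.cont
  refine intervalIntegral.integral_mono_on h₂.riseTime_pos.le
    (Continuous.intervalIntegrable (by fun_prop) _ _)
    (Continuous.intervalIntegrable (by fun_prop) _ _) fun w hw => ?_
  exact mul_le_mul_of_nonneg_left (h w hw.1) hw.1

/-- Monotonicity of the ascent operator. The longer time for the smaller forcing does not spoil the
comparison, because `min a w / w` decreases in `w`: moving first moment to later times lowers the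
values at earlier ones. -/
theorem rise_le_rise {g₁ g₂ : ℝ → ℝ} (h₁ : Admissible g₁) (h₂ : Admissible g₂)
    (h : ∀ a, 0 ≤ a → g₁ a ≤ g₂ a) {a : ℝ} (ha : 0 ≤ a) : rise g₁ a ≤ rise g₂ a := by
  have hT := riseTime_anti h₁ h₂ h
  set S := riseTime g₂ with hS
  set T := riseTime g₁ with hT'
  have hS0 : 0 < S := h₂.riseTime_pos
  have hc₁ := h₁.cont
  have hc₂ := h₂.cont
  set c := min a S / S with hc
  have hc0 : 0 ≤ c := div_nonneg (le_min ha hS0.le) hS0.le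
  have hcS : c * S = min a S := div_mul_cancel₀ _ hS0.ne'
  have hc1 : c ≤ 1 := (div_le_one hS0).2 (min_le_right _ _)
  have e1 : c * ∫ w in (0 : ℝ)..S, w * (g₂ w - g₁ w) ≤
      ∫ w in (0 : ℝ)..S, min a w * (g₂ w - g₁ w) := by
    rw [← intervalIntegral.integral_const_mul]
    refine intervalIntegral.integral_mono_on hS0.le
      (Continuous.intervalIntegrable (by fun_prop) _ _)
      (Continuous.intervalIntegrable (by fun_prop) _ _) fun w hw => ?_
    rw [← mul_assoc]
    refine mul_le_mul_of_nonneg_right ?_ (sub_nonneg.2 (h w hw.1))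
    have h1 : c * w ≤ a :=
      (mul_le_mul_of_nonneg_left hw.2 hc0).trans (hcS.trans_le (min_le_left _ _))
    exact le_min h1 (mul_le_of_le_one_left hw.1 hc1)
  have e2 : ∫ w in S..T, min a w * g₁ w ≤ c * ∫ w in S..T, w * g₁ w := by
    rw [← intervalIntegral.integral_const_mul]
    refine intervalIntegral.integral_mono_on hT
      (Continuous.intervalIntegrable (by fun_prop) _ _)
      (Continuous.intervalIntegrable (by fun_prop) _ _) fun w hw => ?_
    rw [← mul_assoc]
    have hw0 : 0 < w := hS0.trans_le hw.1
    refine mul_le_mul_of_nonneg_right ?_ (h₁.nonneg hw0.le)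
    rcases le_total a S with haS | haS
    · have : min a S = a := min_eq_left haS
      rw [this] at hcS
      refine (min_le_left _ _).trans ?_
      rw [← hcS]
      exact mul_le_mul_of_nonneg_left hw.1 hc0
    · rw [min_eq_right haS] at hcS
      have : c = 1 := by rw [hc, min_eq_right haS, div_self hS0.ne']
      rw [this, one_mul]
      exact min_le_right _ _
  have e3 : ∫ w in (0 : ℝ)..S, w * (g₂ w - g₁ w) = ∫ w in S..T, w * g₁ w := by
    have h3 := firstMoment_sub hc₁ S T
    rw [hT', h₁.riseTime_spec.2, ← h₂.riseTime_spec.2, ← hT', ← hS] at h3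
    rw [← h3, firstMoment, firstMoment, ← intervalIntegral.integral_sub
      (Continuous.intervalIntegrable (by fun_prop) _ _)
      (Continuous.intervalIntegrable (by fun_prop) _ _)]
    exact intervalIntegral.integral_congr fun w _ => by ring
  have e4 : ∫ w in (0 : ℝ)..S, min a w * (g₂ w - g₁ w) =
      rise g₂ a - ∫ w in (0 : ℝ)..S, min a w * g₁ w := by
    rw [rise, ← intervalIntegral.integral_sub
      (Continuous.intervalIntegrable (by fun_prop) _ _)
      (Continuous.intervalIntegrable (by fun_prop) _ _)]
    exact intervalIntegral.integral_congr fun w _ => by ring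
  have e5 : rise g₁ a = (∫ w in (0 : ℝ)..S, min a w * g₁ w) + ∫ w in S..T, min a w * g₁ w :=
    (intervalIntegral.integral_add_adjacent_intervals
      (Continuous.intervalIntegrable (by fun_prop) _ _)
      (Continuous.intervalIntegrable (by fun_prop) _ _)).symm
  rw [e3, e4] at e1
  linarith

theorem admissible_sin : Admissible fun a => Real.sin (min a (Real.pi / 2)) :=
  ⟨by fun_prop, fun _ _ => le_rfl, fun _ _ => Real.sin_le_one _⟩

theorem riseTime_sin : riseTime (fun a => Real.sin (min a (Real.pi / 2))) = Real.pi / 2 :=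
  admissible_sin.riseTime_eq (by positivity) firstMoment_sin

theorem rise_sin {a : ℝ} (ha : 0 ≤ a) :
    rise (fun a => Real.sin (min a (Real.pi / 2))) a = Real.sin (min a (Real.pi / 2)) := by
  rcases le_total (Real.pi / 2) a with h | h
  · rw [admissible_sin.rise_of_le (by rwa [riseTime_sin]), min_eq_right h, Real.sin_pi_div_two]
  · rw [admissible_sin.rise_eq_one_sub ha (by rwa [riseTime_sin]), riseTime_sin, min_eq_left h]
    have e : ∫ w in a..Real.pi / 2, (w - a) * Real.sin (min w (Real.pi / 2))
        = ∫ w in a..Real.pi / 2, (w - a) * Real.sin w := by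
      refine intervalIntegral.integral_congr fun w hw => ?_
      rw [uIcc_of_le h] at hw
      simp [min_eq_left hw.2]
    rw [e, intervalIntegral.integral_eq_sub_of_hasDerivAt
      (f := fun w => Real.sin w - (w - a) * Real.cos w)]
    · simp
    · intro w _
      have := (Real.hasDerivAt_sin w).sub
        (((hasDerivAt_id w).sub_const a).mul (Real.hasDerivAt_cos w))
      refine this.congr_deriv ?_
      simp
    · exact Continuous.intervalIntegrable (by fun_prop) _ _

theorem Admissible.sin_le_rise {g : ℝ → ℝ} (hg : Admissible g) {a : ℝ} (ha : 0 ≤ a) :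
    Real.sin (min a (Real.pi / 2)) ≤ rise g a := by
  rw [← rise_sin ha]
  exact rise_le_rise admissible_sin hg hg.sin_le ha

/-- The ascent operator maps admissible functions to admissible functions. -/
theorem Admissible.rise {g : ℝ → ℝ} (hg : Admissible g) : Admissible (rise g) :=
  ⟨hg.continuous_rise, fun _ ha => hg.sin_le_rise ha, fun a _ => hg.rise_le_one a⟩

/-! ### The sequence `β_n` for delays in `[√2, π/2]` -/

/-- The bound that the descent to a zero imposes on the delayed values at the time `a` after this
zero, namely `r_Δ(ϑ_Δ + a - Δ)`. For `Δ ≥ √2` one has `ϑ_Δ = √2`, and only the quadratic piece of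
`r_Δ` is used. Beyond `a = Δ` this function is negative, which replaces the cut-off by the indicator
of `[-Δ, 0]`. -/
def delayProfile (Δ a : ℝ) : ℝ := 1 - max (a - (Δ - √2)) 0 ^ 2 / 2

theorem continuous_delayProfile (Δ : ℝ) : Continuous (delayProfile Δ) := by
  unfold delayProfile
  fun_prop

theorem delayProfile_le_one (Δ a : ℝ) : delayProfile Δ a ≤ 1 := by
  unfold delayProfile
  linarith [sq_nonneg (max (a - (Δ - √2)) 0)]

theorem delayProfile_anti (Δ : ℝ) : Antitone (delayProfile Δ) := by
  intro a b hab
  unfold delayProfile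
  have : max (a - (Δ - √2)) 0 ≤ max (b - (Δ - √2)) 0 := max_le_max_right _ (by linarith)
  have := pow_le_pow_left₀ (le_max_right _ _) this 2
  linarith

theorem delayProfile_mono_left {Δ Δ' : ℝ} (h : Δ ≤ Δ') (a : ℝ) :
    delayProfile Δ a ≤ delayProfile Δ' a := by
  unfold delayProfile
  have : max (a - (Δ' - √2)) 0 ≤ max (a - (Δ - √2)) 0 := max_le_max_right _ (by linarith)
  have := pow_le_pow_left₀ (le_max_right _ _) this 2
  linarith

theorem delayProfile_self (Δ : ℝ) : delayProfile Δ Δ = 0 := by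
  unfold delayProfile
  rw [sub_sub_cancel, max_eq_left (Real.sqrt_nonneg 2), Real.sq_sqrt zero_le_two]
  norm_num

theorem descentSol_eq_of_le {Δ t : ℝ} (hΔ : 0 ≤ Δ) (ht : t ≤ Δ) :
    descentSol Δ t = 1 - max t 0 ^ 2 / 2 := by
  rw [descentSol, tsum_eq_sum (s := Finset.range 2)]
  · simp [Finset.sum_range_succ, descentTerm]
    ring
  · intro k hk
    have hk : 1 < k := by simpa using hk
    have h1 : (2 : ℝ) ≤ k := by exact_mod_cast Nat.succ_le_of_lt hk
    have h : t - ((k : ℝ) - 1) * Δ ≤ 0 := by nlinarith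
    rw [descentTerm, max_eq_right h, zero_pow (by omega), mul_zero]

theorem descentZero_eq {Δ : ℝ} (hΔ : √2 ≤ Δ) : descentZero Δ = √2 := by
  have h2 := Real.sq_sqrt (zero_le_two (α := ℝ))
  have h0 := Real.sqrt_nonneg 2
  refine IsLeast.csInf_eq ⟨⟨h0, ?_⟩, fun t ht => ?_⟩
  · rw [descentSol_eq_of_le (h0.trans hΔ) hΔ, max_eq_left h0, h2]
    norm_num
  · by_contra! hlt
    have h := ht.2
    rw [descentSol_eq_of_le (h0.trans hΔ) (hlt.le.trans hΔ), max_eq_left ht.1] at h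
    nlinarith [ht.1]

theorem ascentForcing_neg {Δ : ℝ} (hΔ : √2 ≤ Δ) {β : ℝ → ℝ} {a : ℝ} (ha : 0 ≤ a)
    (hβ : 0 ≤ β (-a)) : ascentForcing 1 Δ β (-a) = max (β (-a)) (delayProfile Δ a) := by
  have h0 := Real.sqrt_nonneg 2
  rw [ascentForcing, one_mul, descentZero_eq hΔ]
  by_cases h : a ≤ Δ
  · rw [indicator_of_mem (by constructor <;> linarith),
      descentSol_eq_of_le (h0.trans hΔ) (by linarith), delayProfile]
    ring_nf
  · push Not at h
    rw [indicator_of_notMem (by rintro ⟨h1, -⟩; linarith), max_eq_left hβ, max_eq_left]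
    exact ((delayProfile_anti Δ h.le).trans_eq (delayProfile_self Δ)).trans hβ

/-- Cauchy's formula for the iterated integral. -/
theorem integral_integral_eq {k : ℝ → ℝ} (hk : Continuous k) (v t : ℝ) :
    ∫ s in v..t, ∫ w in v..s, k w = ∫ w in v..t, (t - w) * k w := by
  have hd : ∀ s, HasDerivAt (fun s => ∫ w in v..s, k w) (k s) s := fun s =>
    (Continuous.integral_hasStrictDerivAt hk v s).hasDerivAt
  have h := intervalIntegral.integral_mul_deriv_eq_deriv_mul (a := v) (b := t)
    (u := fun w => t - w) (u' := fun _ => -1) (v := fun s => ∫ w in v..s, k w) (v' := k)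
    (fun x _ => by simpa using (hasDerivAt_id x).const_sub t) (fun x _ => hd x)
    (by simp) (hk.intervalIntegrable _ _)
  rw [h]
  simp

/-- The sequence `β_n` in reversed time: the argument is the time after the zero. -/
def riseSeq (Δ : ℝ) : ℕ → ℝ → ℝ
  | 0 => fun _ => 1
  | n + 1 => rise fun a => max (riseSeq Δ n a) (delayProfile Δ a)

/-- The forcing `g_n = max {β_n, r_Δ}` in reversed time. -/
def riseForcing (Δ : ℝ) (n : ℕ) (a : ℝ) : ℝ := max (riseSeq Δ n a) (delayProfile Δ a)

theorem riseSeq_succ (Δ : ℝ) (n : ℕ) : riseSeq Δ (n + 1) = rise (riseForcing Δ n) := rfl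

theorem Admissible.max_delayProfile {b : ℝ → ℝ} (hb : Admissible b) (Δ : ℝ) :
    Admissible fun a => max (b a) (delayProfile Δ a) :=
  ⟨hb.cont.max (continuous_delayProfile Δ), fun a ha => (hb.sin_le a ha).trans (le_max_left _ _),
    fun a ha => max_le (hb.le_one a ha) (delayProfile_le_one Δ a)⟩

theorem admissible_riseSeq (Δ : ℝ) (n : ℕ) : Admissible (riseSeq Δ n) := by
  induction n with
  | zero => exact ⟨continuous_const, fun _ _ => Real.sin_le_one _, fun _ _ => le_rfl⟩
  | succ n ih => exact (ih.max_delayProfile Δ).rise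

theorem admissible_riseForcing (Δ : ℝ) (n : ℕ) : Admissible (riseForcing Δ n) :=
  (admissible_riseSeq Δ n).max_delayProfile Δ

section Reverse

variable {Δ : ℝ} {β b : ℝ → ℝ}

/-- The double integrals that define `ϖ_n` and `β_{n+1}`, in reversed time. -/
theorem integral_integral_ascentForcing (hΔ : √2 ≤ Δ) (hb : Admissible b)
    (h : ∀ a, 0 ≤ a → β (-a) = b a) {a ω : ℝ} (ha : 0 ≤ a) (haω : a ≤ ω) :
    ∫ s in (-ω)..(-a), ∫ w in (-ω)..s, ascentForcing 1 Δ β w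
      = ∫ w in a..ω, (w - a) * max (b w) (delayProfile Δ w) := by
  have hc := (hb.max_delayProfile Δ).cont
  have e : ∀ w ≤ 0, ascentForcing 1 Δ β w = max (b (-w)) (delayProfile Δ (-w)) := by
    intro w hw
    have h1 := h (-w) (by linarith)
    have h2 := ascentForcing_neg hΔ (β := β) (a := -w) (by linarith)
      (by rw [h1]; exact hb.nonneg (by linarith))
    rwa [h1, neg_neg] at h2
  have e1 : ∫ s in (-ω)..(-a), ∫ w in (-ω)..s, ascentForcing 1 Δ β w =
      ∫ s in (-ω)..(-a), ∫ w in (-ω)..s, max (b (-w)) (delayProfile Δ (-w)) := by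
    refine intervalIntegral.integral_congr fun s hs => ?_
    rw [uIcc_of_le (by linarith)] at hs
    refine intervalIntegral.integral_congr fun w hw => ?_
    rw [uIcc_of_le hs.1] at hw
    exact e w (by linarith [hw.2, hs.2])
  have hc' : Continuous fun w => max (b (-w)) (delayProfile Δ (-w)) := hc.comp continuous_neg
  rw [e1, integral_integral_eq hc',
    ← intervalIntegral.integral_comp_neg fun w => (-a - w) * max (b (-w)) (delayProfile Δ (-w))]
  refine intervalIntegral.integral_congr fun w _ => ?_
  simp only [neg_neg]
  ring

theorem ascentTime_eq (hΔ : √2 ≤ Δ) (hb : Admissible b) (h : ∀ a, 0 ≤ a → β (-a) = b a) :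
    ascentTime 1 Δ β = riseTime fun a => max (b a) (delayProfile Δ a) := by
  rw [ascentTime, riseTime]
  congr 1
  ext ω
  refine and_congr_right fun hω => ?_
  have e := integral_integral_ascentForcing hΔ hb h le_rfl hω.le
  rw [neg_zero] at e
  rw [ascentHeight, e, firstMoment]
  simp

end Reverse

theorem ascentSeq_neg {Δ : ℝ} (hΔ : √2 ≤ Δ) (n : ℕ) :
    ∀ a, 0 ≤ a → ascentSeq 1 Δ n (-a) = riseSeq Δ n a := by
  induction n with
  | zero => exact fun _ _ => rfl
  | succ n ih =>
    intro a ha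
    have hA := admissible_riseForcing Δ n
    have hT : ascentTime 1 Δ (ascentSeq 1 Δ n) = riseTime (riseForcing Δ n) :=
      ascentTime_eq hΔ (admissible_riseSeq Δ n) ih
    rw [ascentSeq, riseSeq_succ, hT]
    dsimp only
    split_ifs with hle
    · exact (hA.rise_of_le (by linarith)).symm
    · rw [hA.rise_eq_one_sub ha (by linarith), integral_integral_ascentForcing hΔ
        (admissible_riseSeq Δ n) ih ha (by linarith)]
      rfl

/-- The numbers `ϖ_n`. -/
def riseTimeSeq (Δ : ℝ) (n : ℕ) : ℝ := riseTime (riseForcing Δ n)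

theorem Psi_eq {Δ : ℝ} (hΔ : √2 ≤ Δ) : Psi 1 Δ = limUnder atTop (riseTimeSeq Δ) := by
  rw [Psi]
  congr 1
  funext n
  exact ascentTime_eq hΔ (admissible_riseSeq Δ n) (ascentSeq_neg hΔ n)

theorem riseSeq_succ_le (Δ : ℝ) (n : ℕ) :
    ∀ a, 0 ≤ a → riseSeq Δ (n + 1) a ≤ riseSeq Δ n a := by
  induction n with
  | zero => exact fun a _ => (admissible_riseForcing Δ 0).rise_le_one a
  | succ n ih =>
    intro a ha
    exact rise_le_rise (admissible_riseForcing Δ (n + 1)) (admissible_riseForcing Δ n)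
      (fun w hw => max_le_max_right _ (ih w hw)) ha

theorem monotone_riseTimeSeq (Δ : ℝ) : Monotone (riseTimeSeq Δ) :=
  monotone_nat_of_le_succ fun n =>
    riseTime_anti (admissible_riseForcing Δ (n + 1)) (admissible_riseForcing Δ n)
      fun w hw => max_le_max_right _ (riseSeq_succ_le Δ n w hw)

theorem riseTimeSeq_mem (Δ : ℝ) (n : ℕ) : riseTimeSeq Δ n ∈ Icc (√2) (Real.pi / 2) :=
  (admissible_riseForcing Δ n).riseTime_spec.1

theorem tendsto_riseTimeSeq {Δ : ℝ} (hΔ : √2 ≤ Δ) :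
    Tendsto (riseTimeSeq Δ) atTop (𝓝 (Psi 1 Δ)) := by
  rw [Psi_eq hΔ]
  refine tendsto_nhds_limUnder ⟨_, tendsto_atTop_ciSup (monotone_riseTimeSeq Δ) ?_⟩
  exact ⟨Real.pi / 2, by rintro _ ⟨n, rfl⟩; exact (riseTimeSeq_mem Δ n).2⟩

theorem riseTimeSeq_le_Psi {Δ : ℝ} (hΔ : √2 ≤ Δ) (n : ℕ) : riseTimeSeq Δ n ≤ Psi 1 Δ :=
  (monotone_riseTimeSeq Δ).ge_of_tendsto (tendsto_riseTimeSeq hΔ) n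

theorem riseSeq_mono_left {Δ Δ' : ℝ} (h : Δ ≤ Δ') (n : ℕ) :
    ∀ a, 0 ≤ a → riseSeq Δ n a ≤ riseSeq Δ' n a := by
  induction n with
  | zero => exact fun _ _ => le_rfl
  | succ n ih =>
    intro a ha
    exact rise_le_rise (admissible_riseForcing Δ n) (admissible_riseForcing Δ' n)
      (fun w hw => max_le_max (ih w hw) (delayProfile_mono_left h w)) ha

/-- A longer delay allows more forcing, hence a faster ascent. This makes the fixed point of
`Ψ(1, ·)` unique. -/
theorem Psi_anti {Δ Δ' : ℝ} (hΔ : √2 ≤ Δ) (h : Δ ≤ Δ') : Psi 1 Δ' ≤ Psi 1 Δ :=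
  le_of_tendsto_of_tendsto' (tendsto_riseTimeSeq (hΔ.trans h)) (tendsto_riseTimeSeq hΔ) fun n =>
    riseTime_anti (admissible_riseForcing Δ n) (admissible_riseForcing Δ' n)
      fun w hw => max_le_max (riseSeq_mono_left h n w hw) (delayProfile_mono_left h w)

/-! ### The fixed point of `Ψ(1, ·)` -/

/-- The forcing of the limiting ascent at the fixed point `Δ = ϖ = γ`. In the time `u = γ - a` to
the maximum it is `max {cos u, 1 - [√2 - u]² / 2}` and depends on `γ` through `u` only. From `a = γ`
on it is `1`. -/
def fixForcing (γ a : ℝ) : ℝ := max (Real.cos (max (γ - a) 0)) (delayProfile γ a)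

theorem admissible_fixForcing {γ : ℝ} (hγ : γ ∈ Icc (√2) (Real.pi / 2)) :
    Admissible (fixForcing γ) := by
  have hc := continuous_delayProfile γ
  refine ⟨by unfold fixForcing; fun_prop, fun a ha => ?_,
    fun a _ => max_le (Real.cos_le_one _) (delayProfile_le_one γ a)⟩
  refine le_trans ?_ (le_max_left _ _)
  rcases le_total γ a with h | h
  · rw [max_eq_right (by linarith), Real.cos_zero]
    exact Real.sin_le_one _
  · rw [max_eq_left (by linarith), min_eq_left (h.trans hγ.2), ← Real.cos_pi_div_two_sub]
    exact Real.cos_le_cos_of_nonneg_of_le_pi (by linarith) (by linarith [Real.pi_pos])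
      (by linarith [hγ.2])

theorem sqrt_two_lt_pi_div_two : √2 < Real.pi / 2 := by
  rw [Real.sqrt_lt' (by positivity)]
  nlinarith [Real.pi_gt_three]

/-- The first moment over `[0, γ]` depends continuously on `γ`. It is at most `1` for `γ = √2`, where
the forcing is at most `1`, and exceeds `1` for `γ = π / 2`, where the forcing exceeds the sine. -/
theorem exists_firstMoment_fixForcing :
    ∃ γ ∈ Ico (√2) (Real.pi / 2), firstMoment (fixForcing γ) γ = 1 := by
  set m : ℝ → ℝ := fun u => max (Real.cos (max u 0)) (1 - max (√2 - u) 0 ^ 2 / 2) with hm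
  have hmc : Continuous m := by rw [hm]; fun_prop
  have e : ∀ γ, firstMoment (fixForcing γ) γ
      = γ * (∫ u in (0 : ℝ)..γ, m u) - ∫ u in (0 : ℝ)..γ, u * m u := by
    intro γ
    have h1 : firstMoment (fixForcing γ) γ = ∫ w in (0 : ℝ)..γ, (γ - (γ - w)) * m (γ - w) := by
      refine intervalIntegral.integral_congr fun w _ => ?_
      simp only [hm, fixForcing, delayProfile]
      ring_nf
    rw [h1, intervalIntegral.integral_comp_sub_left (fun u => (γ - u) * m u) γ, sub_self, sub_zero,
      ← intervalIntegral.integral_const_mul, ← intervalIntegral.integral_sub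
      (Continuous.intervalIntegrable (by fun_prop) _ _)
      (Continuous.intervalIntegrable (by fun_prop) _ _)]
    exact intervalIntegral.integral_congr fun w _ => by ring
  have hcont : Continuous fun γ => firstMoment (fixForcing γ) γ := by
    simp only [e]
    have c1 : Continuous fun γ => ∫ u in (0 : ℝ)..γ, m u :=
      intervalIntegral.continuous_primitive (fun _ _ => hmc.intervalIntegrable _ _) 0
    have c2 : Continuous fun γ => ∫ u in (0 : ℝ)..γ, u * m u :=
      intervalIntegral.continuous_primitive
        (fun _ _ => Continuous.intervalIntegrable (by fun_prop) _ _) 0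
    fun_prop
  have hlo : firstMoment (fixForcing (√2)) (√2) ≤ 1 :=
    ((admissible_fixForcing ⟨le_rfl, sqrt_two_lt_pi_div_two.le⟩).firstMoment_le
      (Real.sqrt_nonneg 2)).trans (by simp)
  have hhi : 1 < firstMoment (fixForcing (Real.pi / 2)) (Real.pi / 2) := by
    have hA := admissible_fixForcing (γ := Real.pi / 2) ⟨sqrt_two_lt_pi_div_two.le, le_rfl⟩
    have hc := hA.cont
    have h2 := sqrt_two_lt_pi_div_two
    have h0 := Real.sqrt_pos.2 (zero_lt_two (α := ℝ))
    rw [← firstMoment_sin]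
    refine intervalIntegral.integral_lt_integral_of_continuousOn_of_le_of_exists_lt
      (by positivity) (Continuous.continuousOn (by fun_prop))
      (Continuous.continuousOn (by fun_prop))
      (fun w hw => mul_le_mul_of_nonneg_left (hA.sin_le w hw.1.le) hw.1.le) ?_
    -- At the time `√2` before the maximum the delayed forcing is already `1`.
    refine ⟨Real.pi / 2 - √2, ⟨by linarith, by linarith⟩, ?_⟩
    refine mul_lt_mul_of_pos_left ?_ (by linarith)
    beta_reduce
    rw [min_eq_left (by linarith), Real.sin_pi_div_two_sub]
    refine lt_of_lt_of_le ?_ (le_max_right _ _)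
    have : delayProfile (Real.pi / 2) (Real.pi / 2 - √2) = 1 := by simp [delayProfile]
    rw [this, ← Real.cos_zero]
    exact Real.cos_lt_cos_of_nonneg_of_le_pi_div_two le_rfl h2.le h0
  obtain ⟨γ, hγ, h⟩ := intermediate_value_Icc sqrt_two_lt_pi_div_two.le hcont.continuousOn
    ⟨hlo, hhi.le⟩
  refine ⟨γ, ⟨hγ.1, lt_of_le_of_ne hγ.2 ?_⟩, h⟩
  rintro rfl
  exact hhi.ne' h

section FixedPoint

variable {γ : ℝ} (hγ : γ ∈ Ico (√2) (Real.pi / 2)) (h1 : firstMoment (fixForcing γ) γ = 1)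
include hγ h1

theorem riseTime_fixForcing : riseTime (fixForcing γ) = γ :=
  (admissible_fixForcing ⟨hγ.1, hγ.2.le⟩).riseTime_eq (lt_of_lt_of_le (by positivity) hγ.1) h1

theorem rise_fixForcing_of_le {a : ℝ} (ha : 0 ≤ a) (haγ : a ≤ γ)
    (h : delayProfile γ a ≤ Real.cos (γ - a)) : rise (fixForcing γ) a = Real.cos (γ - a) := by
  have hA := admissible_fixForcing ⟨hγ.1, hγ.2.le⟩
  rw [hA.rise_eq_one_sub ha (by rwa [riseTime_fixForcing hγ h1]), riseTime_fixForcing hγ h1]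
  have e : ∫ w in a..γ, (w - a) * fixForcing γ w = ∫ w in a..γ, (w - a) * Real.cos (γ - w) := by
    refine intervalIntegral.integral_congr fun w hw => ?_
    rw [uIcc_of_le haγ] at hw
    have h2 : Real.cos (γ - a) ≤ Real.cos (γ - w) :=
      Real.cos_le_cos_of_nonneg_of_le_pi (by linarith [hw.2])
        (by linarith [hγ.2, Real.pi_pos]) (by linarith [hw.1])
    have h3 : delayProfile γ w ≤ Real.cos (γ - w) :=
      ((delayProfile_anti γ hw.1).trans h).trans h2
    simp only [fixForcing]
    rw [max_eq_left (by linarith [hw.2] : 0 ≤ γ - w), max_eq_left h3]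
  rw [e, intervalIntegral.integral_eq_sub_of_hasDerivAt
    (f := fun w => Real.cos (γ - w) - (w - a) * Real.sin (γ - w))]
  · simp
  · intro w _
    have hs := (hasDerivAt_id w).const_sub γ
    have := hs.cos.sub (((hasDerivAt_id w).sub_const a).mul hs.sin)
    refine this.congr_deriv ?_
    simp
  · exact Continuous.intervalIntegrable (by fun_prop) _ _

/-- The forcing `fixForcing γ` belongs to a fixed point of the iteration: before the profile
overtakes the cosine, the ascent coincides with the cosine; after that, both the cosine and the
ascent lie below the profile (in the direction from the maximum to the zero). -/
theorem max_rise_fixForcing {a : ℝ} (ha : 0 ≤ a) :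
    max (rise (fixForcing γ) a) (delayProfile γ a) = fixForcing γ a := by
  have hA := admissible_fixForcing ⟨hγ.1, hγ.2.le⟩
  rw [fixForcing]
  rcases le_total γ a with h | h
  · rw [hA.rise_of_le (by rwa [riseTime_fixForcing hγ h1]), max_eq_right (by linarith : γ - a ≤ 0),
      Real.cos_zero]
  · rw [max_eq_left (by linarith : 0 ≤ γ - a)]
    rcases le_total (delayProfile γ a) (Real.cos (γ - a)) with hle | hle
    · rw [rise_fixForcing_of_le hγ h1 ha h hle]
    · rw [max_eq_right hle, max_eq_right]
      obtain ⟨c, hc, hc0⟩ := intermediate_value_Icc h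
        (f := fun w => Real.cos (γ - w) - delayProfile γ w)
        (by have := continuous_delayProfile γ; fun_prop) (show (0 : ℝ) ∈ _ by
          constructor
          · linarith
          · simp [delayProfile_self])
      have hc1 : Real.cos (γ - c) = delayProfile γ c := by linarith
      calc rise (fixForcing γ) a ≤ rise (fixForcing γ) c := hA.rise_mono hc.1
        _ = Real.cos (γ - c) :=
          rise_fixForcing_of_le hγ h1 (ha.trans hc.1) hc.2 hc1.ge
        _ = delayProfile γ c := hc1
        _ ≤ delayProfile γ a := delayProfile_anti γ hc.1

theorem rise_fixForcing_le_riseSeq (n : ℕ) :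
    ∀ a, 0 ≤ a → rise (fixForcing γ) a ≤ riseSeq γ n a := by
  have hA := admissible_fixForcing ⟨hγ.1, hγ.2.le⟩
  induction n with
  | zero => exact fun a _ => hA.rise_le_one a
  | succ n ih =>
    intro a ha
    refine rise_le_rise hA (admissible_riseForcing γ n) (fun w hw => ?_) ha
    rw [← max_rise_fixForcing hγ h1 hw]
    exact max_le_max_right _ (ih w hw)

theorem fixForcing_le_riseForcing (n : ℕ) {a : ℝ} (ha : 0 ≤ a) :
    fixForcing γ a ≤ riseForcing γ n a := by
  rw [← max_rise_fixForcing hγ h1 ha]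
  exact max_le_max_right _ (rise_fixForcing_le_riseSeq hγ h1 n a ha)

theorem riseForcing_sub_le (n : ℕ) {a : ℝ} (ha : 0 ≤ a) :
    riseForcing γ n a - fixForcing γ a ≤ riseSeq γ n a - rise (fixForcing γ) a := by
  rw [← max_rise_fixForcing hγ h1 ha, riseForcing, sub_le_iff_le_add]
  refine max_le ?_ ?_
  · linarith [le_max_left (rise (fixForcing γ) a) (delayProfile γ a)]
  · linarith [le_max_right (rise (fixForcing γ) a) (delayProfile γ a),
      rise_fixForcing_le_riseSeq hγ h1 n a ha]

theorem riseTimeSeq_le_fix (n : ℕ) : riseTimeSeq γ n ≤ γ :=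
  (riseTime_anti (admissible_fixForcing ⟨hγ.1, hγ.2.le⟩) (admissible_riseForcing γ n)
    fun _ hw => fixForcing_le_riseForcing hγ h1 n hw).trans_eq (riseTime_fixForcing hγ h1)

/-- The distance to the fixed point is mapped by (at most) the Green operator of `-d²/da²` on
`[0, γ]`. -/
theorem riseSeq_succ_sub_le (n : ℕ) (a : ℝ) (ha : 0 ≤ a) :
    riseSeq γ (n + 1) a - rise (fixForcing γ) a ≤
      ∫ w in (0 : ℝ)..γ, min a w * (riseForcing γ n w - fixForcing γ w) := by
  have hA := admissible_fixForcing ⟨hγ.1, hγ.2.le⟩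
  have hc := hA.cont
  have hc' := (admissible_riseForcing γ n).cont
  have hγ0 : 0 ≤ γ := (Real.sqrt_nonneg 2).trans hγ.1
  have e : ∫ w in (0 : ℝ)..γ, min a w * (riseForcing γ n w - fixForcing γ w)
      = (∫ w in (0 : ℝ)..γ, min a w * riseForcing γ n w) - rise (fixForcing γ) a := by
    rw [rise, riseTime_fixForcing hγ h1, ← intervalIntegral.integral_sub
      (Continuous.intervalIntegrable (by fun_prop) _ _)
      (Continuous.intervalIntegrable (by fun_prop) _ _)]
    exact intervalIntegral.integral_congr fun w _ => by ring
  rw [e, riseSeq_succ, rise, ← intervalIntegral.integral_add_adjacent_intervals (c := γ)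
      (b := riseTime (riseForcing γ n)) (f := fun w => min a w * riseForcing γ n w)
    (Continuous.intervalIntegrable (by fun_prop) _ _)
    (Continuous.intervalIntegrable (by fun_prop) _ _)]
  have : 0 ≤ ∫ w in riseTime (riseForcing γ n)..γ, min a w * riseForcing γ n w := by
    refine intervalIntegral.integral_nonneg (riseTimeSeq_le_fix hγ h1 n) fun w hw => ?_
    have hw0 : 0 ≤ w := (admissible_riseForcing γ n).riseTime_pos.le.trans hw.1
    exact mul_nonneg (le_min ha hw0) ((admissible_riseForcing γ n).nonneg hw0)
  linarith

omit hγ h1 in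
/-- The first eigenfunction of the Green operator on `[0, γ]`. -/
theorem integral_min_mul_sin {μ : ℝ} (hμ : μ ≠ 0) (hγμ : μ * γ = Real.pi / 2) {a : ℝ}
    (ha : 0 ≤ a) (haγ : a ≤ γ) :
    ∫ w in (0 : ℝ)..γ, min a w * Real.sin (μ * w) = Real.sin (μ * a) / μ ^ 2 := by
  rw [Admissible.integral_min_mul (g := fun w => Real.sin (μ * w)) (by fun_prop) ha haγ,
    firstMoment]
  have hm : ∀ w, HasDerivAt (fun w => μ * w) μ w := fun w => by
    simpa using (hasDerivAt_id w).const_mul μ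
  rw [intervalIntegral.integral_eq_sub_of_hasDerivAt
    (f := fun w => Real.sin (μ * w) / μ ^ 2 - w * (Real.cos (μ * w) / μ)),
    intervalIntegral.integral_eq_sub_of_hasDerivAt (f := fun w => -(Real.cos (μ * w) / μ))]
  · rw [hγμ]
    simp
  · intro w _
    refine ((hm w).cos.div_const μ).neg.congr_deriv ?_
    field_simp
  · exact Continuous.intervalIntegrable (by fun_prop) _ _
  · intro w _
    refine (((hm w).sin.div_const (μ ^ 2)).sub
      ((hasDerivAt_id w).mul ((hm w).cos.div_const μ))).congr_deriv ?_
    simp only [id]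
    field_simp
    ring
  · exact Continuous.intervalIntegrable (by fun_prop) _ _

/-- Geometric convergence to the fixed point: as `γ < π / 2`, the Green operator on `[0, γ]`
contracts its first eigenfunction. -/
theorem riseSeq_sub_le (n : ℕ) : ∀ a ∈ Icc 0 γ, riseSeq γ (n + 1) a - rise (fixForcing γ) a ≤
    (2 * γ / Real.pi) ^ (2 * n) * (γ ^ 2 * Real.sin (Real.pi / (2 * γ) * a)) := by
  have hA := admissible_fixForcing ⟨hγ.1, hγ.2.le⟩
  have hγ0 : 0 < γ := lt_of_lt_of_le (by positivity) hγ.1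
  have hπ := Real.pi_pos
  have hc := hA.cont
  have hμ : Real.pi / (2 * γ) ≠ 0 := by positivity
  have hγμ : Real.pi / (2 * γ) * γ = Real.pi / 2 := by field_simp
  induction n with
  | zero =>
    intro a ha
    have hc' := (admissible_riseForcing γ 0).cont
    have hb : ∫ w in (0 : ℝ)..γ, min a w * (riseForcing γ 0 w - fixForcing γ w) ≤
        ∫ _ in (0 : ℝ)..γ, a := by
      refine intervalIntegral.integral_mono_on hγ0.le
        (Continuous.intervalIntegrable (by fun_prop) _ _)
        (Continuous.intervalIntegrable (by fun_prop) _ _) fun w hw => ?_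
      have h2 := hA.nonneg hw.1
      have h3 := (admissible_riseForcing γ 0).le_one w hw.1
      exact (mul_le_of_le_one_right (le_min ha.1 hw.1) (by linarith)).trans (min_le_left _ _)
    have hs : a / γ ≤ Real.sin (Real.pi / (2 * γ) * a) := by
      have := Real.mul_le_sin (x := Real.pi / (2 * γ) * a)
        (mul_nonneg (by positivity) ha.1)
        ((mul_le_mul_of_nonneg_left ha.2 (by positivity)).trans_eq hγμ)
      refine le_trans (le_of_eq ?_) this
      field_simp
    refine (riseSeq_succ_sub_le hγ h1 0 a ha.1).trans (hb.trans ?_)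
    simp only [intervalIntegral.integral_const, smul_eq_mul, sub_zero, mul_zero, pow_zero, one_mul]
    calc γ * a = γ ^ 2 * (a / γ) := by field_simp
      _ ≤ _ := mul_le_mul_of_nonneg_left hs (by positivity)
  | succ n ih =>
    intro a ha
    have hc' := (admissible_riseForcing γ (n + 1)).cont
    set C := (2 * γ / Real.pi) ^ (2 * n) * γ ^ 2 with hC
    have hb : ∫ w in (0 : ℝ)..γ, min a w * (riseForcing γ (n + 1) w - fixForcing γ w) ≤
        ∫ w in (0 : ℝ)..γ, C * (min a w * Real.sin (Real.pi / (2 * γ) * w)) := by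
      refine intervalIntegral.integral_mono_on hγ0.le
        (Continuous.intervalIntegrable (by fun_prop) _ _)
        (Continuous.intervalIntegrable (by fun_prop) _ _) fun w hw => ?_
      have h2 := (riseForcing_sub_le hγ h1 (n + 1) hw.1).trans (ih w hw)
      calc min a w * (riseForcing γ (n + 1) w - fixForcing γ w) ≤ min a w * _ :=
            mul_le_mul_of_nonneg_left h2 (le_min ha.1 hw.1)
        _ = _ := by rw [hC]; ring
    refine (riseSeq_succ_sub_le hγ h1 (n + 1) a ha.1).trans (hb.trans (le_of_eq ?_))
    rw [intervalIntegral.integral_const_mul, integral_min_mul_sin hμ hγμ ha.1 ha.2, hC]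
    rw [show 2 * (n + 1) = 2 * n + 2 by ring, pow_add]
    field_simp

/-- `Ψ(1, γ) = γ`. -/
theorem Psi_fix : Psi 1 γ = γ := by
  have hA := admissible_fixForcing ⟨hγ.1, hγ.2.le⟩
  have hγ0 : 0 < γ := lt_of_lt_of_le (by positivity) hγ.1
  have hπ := Real.pi_pos
  have hlim := tendsto_riseTimeSeq hγ.1
  refine le_antisymm (le_of_tendsto' hlim (riseTimeSeq_le_fix hγ h1)) ?_
  have hPsi0 : 0 ≤ Psi 1 γ := (Real.sqrt_nonneg 2).trans
    ((riseTimeSeq_mem γ 0).1.trans (riseTimeSeq_le_Psi hγ.1 0))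
  have hfix : firstMoment (fixForcing γ) γ ≤ firstMoment (fixForcing γ) (Psi 1 γ) := by
    have hq : Tendsto (fun n : ℕ => (2 * γ / Real.pi) ^ (2 * n) * γ ^ 4) atTop (𝓝 0) := by
      simp only [pow_mul]
      rw [← zero_mul (γ ^ 4)]
      refine (tendsto_pow_atTop_nhds_zero_of_lt_one (by positivity) ?_).mul_const _
      have : 2 * γ / Real.pi < 1 := by
        rw [div_lt_one hπ]
        linarith [hγ.2]
      exact pow_lt_one₀ (by positivity) this two_ne_zero
    have hlim' : Tendsto (fun n => firstMoment (fixForcing γ) (riseTimeSeq γ (n + 1))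
        + (2 * γ / Real.pi) ^ (2 * n) * γ ^ 4) atTop
        (𝓝 (firstMoment (fixForcing γ) (Psi 1 γ) + 0)) :=
      (((hasDerivAt_firstMoment hA.cont _).continuousAt.tendsto.comp
        (hlim.comp (tendsto_add_atTop_nat 1)))).add hq
    rw [add_zero] at hlim'
    rw [h1]
    refine ge_of_tendsto' hlim' fun n => ?_
    have hR := admissible_riseForcing γ (n + 1)
    have hc := hA.cont
    have hc' := hR.cont
    have hT := riseTimeSeq_le_fix hγ h1 (n + 1)
    have hT0 : 0 ≤ riseTimeSeq γ (n + 1) := hR.riseTime_pos.le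
    have e : firstMoment (riseForcing γ (n + 1)) (riseTimeSeq γ (n + 1)) = 1 :=
      hR.riseTime_spec.2
    have e2 : firstMoment (riseForcing γ (n + 1)) (riseTimeSeq γ (n + 1)) ≤
        ∫ w in (0 : ℝ)..riseTimeSeq γ (n + 1),
          (w * fixForcing γ w + (2 * γ / Real.pi) ^ (2 * n) * γ ^ 3) := by
      refine intervalIntegral.integral_mono_on hT0
        (Continuous.intervalIntegrable (by fun_prop) _ _)
        (Continuous.intervalIntegrable (by fun_prop) _ _) fun w hw => ?_
      have hwγ : w ≤ γ := hw.2.trans hT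
      have h2 := (riseForcing_sub_le hγ h1 (n + 1) hw.1).trans
        (riseSeq_sub_le hγ h1 n w ⟨hw.1, hwγ⟩)
      have h3 : (2 * γ / Real.pi) ^ (2 * n) * (γ ^ 2 * Real.sin (Real.pi / (2 * γ) * w)) ≤
          (2 * γ / Real.pi) ^ (2 * n) * γ ^ 2 :=
        mul_le_mul_of_nonneg_left (mul_le_of_le_one_right (by positivity) (Real.sin_le_one _))
          (by positivity)
      have h4 := mul_le_mul_of_nonneg_left (h2.trans h3) hw.1
      have h5 : w * ((2 * γ / Real.pi) ^ (2 * n) * γ ^ 2) ≤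
          γ * ((2 * γ / Real.pi) ^ (2 * n) * γ ^ 2) :=
        mul_le_mul_of_nonneg_right hwγ (by positivity)
      nlinarith
    rw [intervalIntegral.integral_add
        (Continuous.intervalIntegrable (by fun_prop) _ _)
        (Continuous.intervalIntegrable (by fun_prop) _ _), intervalIntegral.integral_const,
      smul_eq_mul, sub_zero, e] at e2
    have h6 : riseTimeSeq γ (n + 1) * ((2 * γ / Real.pi) ^ (2 * n) * γ ^ 3) ≤
        γ * ((2 * γ / Real.pi) ^ (2 * n) * γ ^ 3) :=
      mul_le_mul_of_nonneg_right hT (by positivity)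
    have h7 : firstMoment (fixForcing γ) (riseTimeSeq γ (n + 1)) =
      ∫ w in (0 : ℝ)..riseTimeSeq γ (n + 1), w * fixForcing γ w := rfl
    rw [h7]
    linarith
  exact (hA.firstMoment_strictMonoOn.le_iff_le hγ0.le hPsi0).1 hfix

end FixedPoint

theorem existsUnique_fix :
    ∃! γ : ℝ, γ ∈ Icc (√2) (Real.pi / 2) ∧ Psi 1 γ = γ := by
  obtain ⟨γ, hγ, h1⟩ := exists_firstMoment_fixForcing
  have hfix := Psi_fix hγ h1
  refine ⟨γ, ⟨⟨hγ.1, hγ.2.le⟩, hfix⟩, fun δ ⟨hδ, hδfix⟩ => ?_⟩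
  rcases le_total γ δ with h | h
  · have := Psi_anti hγ.1 h
    linarith
  · have := Psi_anti hδ.1 h
    linarith

/-! ### Normalized solutions of the delay equation -/

/-- The integrated form of an equation `y''(t) = c(t) y(t - σ(t))` with `0 ≤ c ≤ 1` and
`0 ≤ σ ≤ D` for `t ≥ α`: the increments of `y'` are bounded above and below by the integral of any
nonnegative bound for `y` and `-y`, respectively, over the delay window `[t - D, t]`. -/
structure IsDelayEvolution (α D : ℝ) (y y' : ℝ → ℝ) : Prop where
  delay_nonneg : 0 ≤ D
  cont : ContinuousOn y (Ici (α - D))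
  hasDerivAt : ∀ t, α < t → HasDerivAt y (y' t) t
  sub_le : ∀ a b, α ≤ a → a ≤ b → ∀ g : ℝ → ℝ, Continuous g → (∀ t ∈ Icc a b, 0 ≤ g t) →
    (∀ t ∈ Icc a b, ∀ σ ∈ Icc (t - D) t, y σ ≤ g t) → y' b - y' a ≤ ∫ t in a..b, g t
  le_sub : ∀ a b, α ≤ a → a ≤ b → ∀ g : ℝ → ℝ, Continuous g → (∀ t ∈ Icc a b, 0 ≤ g t) →
    (∀ t ∈ Icc a b, ∀ σ ∈ Icc (t - D) t, -y σ ≤ g t) → -∫ t in a..b, g t ≤ y' b - y' a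

/-- A function with nonincreasing derivative is nonnegative between two points where it is
nonnegative. -/
theorem nonneg_of_deriv_anti {f f' : ℝ → ℝ} {a b : ℝ} (hc : ContinuousOn f (Icc a b))
    (hd : ∀ t ∈ Ioo a b, HasDerivAt f (f' t) t) (hanti : AntitoneOn f' (Ioo a b))
    (ha : 0 ≤ f a) (hb : 0 ≤ f b) {t : ℝ} (ht : t ∈ Icc a b) : 0 ≤ f t := by
  by_contra! hlt
  have hat : a < t := lt_of_le_of_ne ht.1 (by rintro rfl; exact hlt.not_ge ha)
  have htb : t < b := lt_of_le_of_ne ht.2 (by rintro rfl; exact hlt.not_ge hb)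
  obtain ⟨c, hcm, hcs⟩ := exists_hasDerivAt_eq_slope f f' hat
    (hc.mono (Icc_subset_Icc_right ht.2)) fun x hx => hd x ⟨hx.1, hx.2.trans htb⟩
  obtain ⟨d, hdm, hds⟩ := exists_hasDerivAt_eq_slope f f' htb
    (hc.mono (Icc_subset_Icc_left ht.1)) fun x hx => hd x ⟨hat.trans hx.1, hx.2⟩
  have h1 : f' c < 0 := hcs ▸ div_neg_of_neg_of_pos (by linarith) (by linarith)
  have h2 : 0 < f' d := hds ▸ div_pos (by linarith) (by linarith)
  have := hanti ⟨hcm.1, hcm.2.trans htb⟩ ⟨hat.trans hdm.1, hdm.2⟩ (hcm.2.trans hdm.1).le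
  linarith

namespace IsDelayEvolution

variable {α D : ℝ} {y y' : ℝ → ℝ}

theorem neg (h : IsDelayEvolution α D y y') :
    IsDelayEvolution α D (fun t => -y t) (fun t => -y' t) where
  delay_nonneg := h.delay_nonneg
  cont := h.cont.neg
  hasDerivAt t ht := (h.hasDerivAt t ht).neg
  sub_le a b ha hab g hg h0 hy := by
    have := h.le_sub a b ha hab g hg h0 hy
    linarith
  le_sub a b ha hab g hg h0 hy := by
    have := h.sub_le a b ha hab g hg h0 (by simpa using hy)
    linarith

theorem const_mul (h : IsDelayEvolution α D y y') {c : ℝ} (hc : 0 < c) :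
    IsDelayEvolution α D (fun t => c * y t) (fun t => c * y' t) where
  delay_nonneg := h.delay_nonneg
  cont := continuousOn_const.mul h.cont
  hasDerivAt t ht := (h.hasDerivAt t ht).const_mul c
  sub_le a b ha hab g hg h0 hy := by
    have := h.sub_le a b ha hab (fun t => c⁻¹ * g t) (by fun_prop)
      (fun t ht => mul_nonneg (by positivity) (h0 t ht))
      (fun t ht σ hσ => (le_inv_mul_iff₀ hc).2 (hy t ht σ hσ))
    rw [intervalIntegral.integral_const_mul, le_inv_mul_iff₀ hc] at this
    linarith
  le_sub a b ha hab g hg h0 hy := by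
    have := h.le_sub a b ha hab (fun t => c⁻¹ * g t) (by fun_prop)
      (fun t ht => mul_nonneg (by positivity) (h0 t ht))
      (fun t ht σ hσ => (le_inv_mul_iff₀ hc).2 (by linarith [hy t ht σ hσ]))
    rw [intervalIntegral.integral_const_mul, neg_le, le_inv_mul_iff₀ hc] at this
    linarith

theorem mono_start (h : IsDelayEvolution α D y y') {α' : ℝ} (hα : α ≤ α') :
    IsDelayEvolution α' D y y' where
  delay_nonneg := h.delay_nonneg
  cont := h.cont.mono (Ici_subset_Ici.2 (by linarith))
  hasDerivAt t ht := h.hasDerivAt t (hα.trans_lt ht)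
  sub_le a b ha := h.sub_le a b (hα.trans ha)
  le_sub a b ha := h.le_sub a b (hα.trans ha)

theorem continuousOn_Icc (h : IsDelayEvolution α D y y') {a b : ℝ} (ha : α - D ≤ a) :
    ContinuousOn y (Icc a b) :=
  h.cont.mono fun _ ht => ha.trans ht.1

/-! ### Bounds before and after a zero -/

theorem le_of_zero (h : IsDelayEvolution α D y y') {z : ℝ} (hz : α + √2 < z) (hz0 : y z = 0)
    (hb : ∀ t ∈ Icc (α - D) z, |y t| ≤ 1) {t : ℝ} (ht : t ∈ Icc (z - √2) z) :
    y t ≤ 1 - (√2 - (z - t)) ^ 2 / 2 := by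
  have h2 := Real.sq_sqrt (zero_le_two (α := ℝ))
  have h0 := Real.sqrt_nonneg 2
  have hD := h.delay_nonneg
  rw [← sub_nonneg]
  refine nonneg_of_deriv_anti (f := fun t => 1 - (√2 - (z - t)) ^ 2 / 2 - y t)
    (f' := fun t => -(√2 - (z - t)) - y' t) (a := z - √2) (b := z) ?_ ?_ ?_ ?_ ?_ ht
  · exact ContinuousOn.sub (Continuous.continuousOn (by fun_prop))
      (h.continuousOn_Icc (by linarith))
  · intro s hs
    have h3 := (((((hasDerivAt_id s).const_sub z).const_sub (√2)).pow 2).div_const 2).const_sub 1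
    refine (h3.sub (h.hasDerivAt s (by linarith [hs.1]))).congr_deriv ?_
    simp
  · intro r hr s hs hrs
    have := h.le_sub r s (by linarith [hr.1]) hrs (fun _ => 1) continuous_const
      (fun _ _ => zero_le_one) fun t ht σ hσ =>
        (neg_le_abs _).trans (hb σ ⟨by linarith [hσ.1, ht.1, hr.1], by
          linarith [hσ.2, ht.2, hs.2]⟩)
    simp only [intervalIntegral.integral_const, smul_eq_mul, mul_one] at this
    linarith
  · have := (abs_le.1 (hb (z - √2) ⟨by linarith, by linarith⟩)).2
    simpa using this
  · simp [hz0, h2]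

/-- Before a zero, a solution bounded by `1` is bounded by the descent solution: otherwise, going
back from the zero with `y'' ≥ -1`, it would exceed `1`. -/
theorem abs_le_delayProfile (h : IsDelayEvolution α D y y') {z : ℝ} (hz : α + √2 < z)
    (hz0 : y z = 0) (hb : ∀ t ∈ Icc (α - D) z, |y t| ≤ 1) (γ : ℝ) {t : ℝ}
    (ht : t ∈ Icc (α - D) z) : |y t| ≤ delayProfile γ (γ - (z - t)) := by
  have e : γ - (z - t) - (γ - √2) = √2 - (z - t) := by ring
  rw [delayProfile, e]
  rcases le_total (z - √2) t with hle | hle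
  · rw [max_eq_left (by linarith)]
    refine abs_le.2 ⟨?_, h.le_of_zero hz hz0 hb ⟨hle, ht.2⟩⟩
    have := h.neg.le_of_zero hz (by simp [hz0]) (by simpa using hb) ⟨hle, ht.2⟩
    linarith
  · rw [max_eq_right (by linarith)]
    simpa using hb t ht

/-- After a zero, a solution stays below the ascent with the forcing `g`, as long as the delayed
values are bounded by `g`. -/
theorem le_rise (h : IsDelayEvolution α D y y') {z H : ℝ} (hz : α < z) (hz0 : y z = 0)
    {g : ℝ → ℝ} (hg : Admissible g) (hH : riseTime g ≤ H) (h1 : ∀ t ∈ Icc z (z + H), y t ≤ 1)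
    (hb : ∀ t ∈ Icc z (z + H), ∀ σ ∈ Icc (t - D) t, |y σ| ≤ g (t - z)) {a : ℝ}
    (ha : a ∈ Icc 0 H) : y (z + a) ≤ rise g a := by
  rcases le_total (riseTime g) a with hTa | haT
  · rw [hg.rise_of_le hTa]
    exact h1 _ ⟨by linarith [ha.1], by linarith [ha.2]⟩
  have hD := h.delay_nonneg
  have hcg := hg.cont
  rw [← sub_nonneg]
  refine nonneg_of_deriv_anti (f := fun a => DelayEq.rise g a - y (z + a))
    (f' := fun a => (∫ w in a..riseTime g, g w) - y' (z + a)) (a := 0) (b := riseTime g)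
    ?_ ?_ ?_ ?_ ?_ ⟨ha.1, haT⟩
  · refine hg.continuous_rise.continuousOn.sub (h.cont.comp (by fun_prop) fun a ha => ?_)
    simp only [mem_Ici]
    linarith [ha.1]
  · intro s hs
    exact (hg.hasDerivAt_rise hs).sub
      ((h.hasDerivAt (z + s) (by linarith [hs.1])).comp_const_add z s)
  · intro r hr s hs hrs
    have h3 := h.le_sub (z + r) (z + s) (by linarith [hr.1]) (by linarith)
      (fun t => g (t - z)) (by fun_prop)
      (fun t ht => hg.nonneg (by linarith [ht.1, hr.1]))
      fun t ht σ hσ => (neg_le_abs _).trans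
        (hb t ⟨by linarith [ht.1, hr.1], by linarith [ht.2, hs.2]⟩ σ hσ)
    rw [intervalIntegral.integral_comp_sub_right, add_sub_cancel_left, add_sub_cancel_left] at h3
    have h4 := intervalIntegral.integral_add_adjacent_intervals (a := r) (b := s)
      (c := riseTime g) (hcg.intervalIntegrable (μ := volume) _ _) (hcg.intervalIntegrable _ _)
    simp only
    linarith
  · simp [hg.rise_zero, hz0]
  · have := h1 (z + riseTime g) ⟨by linarith [hg.riseTime_pos], by linarith⟩
    rw [hg.rise_of_le le_rfl]
    linarith

/-- The delayed values after a zero, bounded by the forcing of the next step of the iteration. -/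
theorem abs_le_max (h : IsDelayEvolution α D y y') {γ z H : ℝ} (hD : D ≤ γ) (hz : α + √2 < z)
    (hz0 : y z = 0) (hb : ∀ t ∈ Icc (α - D) (z + H), |y t| ≤ 1) {n : ℕ}
    (hn : ∀ a ∈ Icc 0 H, |y (z + a)| ≤ riseSeq γ n a) {t σ : ℝ} (ht : t ∈ Icc z (z + H))
    (hσ : σ ∈ Icc (t - D) t) :
    (z ≤ σ ∧ |y σ| ≤ riseSeq γ n (t - z)) ∨ (σ ≤ z ∧ |y σ| ≤ delayProfile γ (t - z)) := by
  have h0 := Real.sqrt_nonneg 2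
  rcases le_total z σ with hzσ | hzσ
  · left
    have h1 := hn (σ - z) ⟨by linarith, by linarith [hσ.2, ht.2]⟩
    rw [add_sub_cancel] at h1
    refine ⟨hzσ, h1.trans ?_⟩
    cases n with
    | zero => exact le_rfl
    | succ n => exact (admissible_riseForcing γ n).rise_mono (by linarith [hσ.2])
  · right
    refine ⟨hzσ, (h.abs_le_delayProfile hz hz0 (fun t ht' => hb t
      ⟨ht'.1, by linarith [ht.1, ht.2, ht'.2]⟩) γ ⟨by linarith [hσ.1, ht.1], hzσ⟩).trans ?_⟩
    exact delayProfile_anti γ (by linarith [hσ.1])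

theorem abs_le_riseForcing (h : IsDelayEvolution α D y y') {γ z H : ℝ} (hD : D ≤ γ)
    (hz : α + √2 < z) (hz0 : y z = 0) (hb : ∀ t ∈ Icc (α - D) (z + H), |y t| ≤ 1) {n : ℕ}
    (hn : ∀ a ∈ Icc 0 H, |y (z + a)| ≤ riseSeq γ n a) {t σ : ℝ} (ht : t ∈ Icc z (z + H))
    (hσ : σ ∈ Icc (t - D) t) : |y σ| ≤ riseForcing γ n (t - z) := by
  rcases h.abs_le_max hD hz hz0 hb hn ht hσ with h1 | h1
  · exact h1.2.trans (le_max_left _ _)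
  · exact h1.2.trans (le_max_right _ _)

theorem abs_le_riseSeq_zero {γ z H : ℝ} (hz : α - D ≤ z)
    (hb : ∀ t ∈ Icc (α - D) (z + H), |y t| ≤ 1) :
    ∀ a ∈ Icc 0 H, |y (z + a)| ≤ riseSeq γ 0 a :=
  fun a ha => hb (z + a) ⟨by linarith [ha.1], by linarith [ha.2]⟩

/-- One step of the iteration for the solution. -/
theorem abs_le_riseSeq_succ (h : IsDelayEvolution α D y y') {γ z H : ℝ} (hD : D ≤ γ)
    (hz : α + √2 < z) (hz0 : y z = 0) (hb : ∀ t ∈ Icc (α - D) (z + H), |y t| ≤ 1) {n : ℕ}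
    (hn : ∀ a ∈ Icc 0 H, |y (z + a)| ≤ riseSeq γ n a) (hH : riseTimeSeq γ n ≤ H) :
    ∀ a ∈ Icc 0 H, |y (z + a)| ≤ riseSeq γ (n + 1) a := by
  intro a ha
  have h0 := Real.sqrt_nonneg 2
  have hD0 := h.delay_nonneg
  have hA := admissible_riseForcing γ n
  have hf : ∀ t ∈ Icc z (z + H), ∀ σ ∈ Icc (t - D) t, |y σ| ≤ riseForcing γ n (t - z) :=
    fun t ht σ hσ => h.abs_le_riseForcing hD hz hz0 hb hn ht hσ
  have hb' : ∀ t ∈ Icc z (z + H), |y t| ≤ 1 := fun t ht => hb t ⟨by linarith [ht.1], ht.2⟩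
  refine abs_le.2 ⟨?_, h.le_rise (by linarith) hz0 hA hH
    (fun t ht => (le_abs_self _).trans (hb' t ht)) hf ha⟩
  have := h.neg.le_rise (by linarith) (by simp [hz0]) hA hH
    (fun t ht => (neg_le_abs _).trans (hb' t ht)) (by simpa using hf) ha
  rw [riseSeq_succ]
  linarith

/-- The height of a maximum at the time `T` after a zero. -/
theorem le_firstMoment (h : IsDelayEvolution α D y y') {z T : ℝ} (hz : α < z) (hT : 0 ≤ T)
    (hz0 : y z = 0) (hT0 : y' (z + T) = 0) {k : ℝ → ℝ} (hk : Continuous k)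
    (hk0 : ∀ a ∈ Icc 0 T, 0 ≤ k a)
    (hb : ∀ t ∈ Icc z (z + T), ∀ σ ∈ Icc (t - D) t, -y σ ≤ k (t - z)) :
    y (z + T) ≤ firstMoment k T := by
  have hmono : MonotoneOn (fun a => firstMoment k a - a * (∫ w in T..a, k w) - y (z + a))
      (Icc 0 T) := by
    have hd : ∀ a, 0 ≤ a → HasDerivAt
        (fun a => firstMoment k a - a * (∫ w in T..a, k w) - y (z + a))
        (a * k a - (1 * (∫ w in T..a, k w) + a * k a) - y' (z + a)) a := by
      intro a ha
      have h1 := (hasDerivAt_id a).mul (Continuous.integral_hasStrictDerivAt hk T a).hasDerivAt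
      have h2 := (h.hasDerivAt (z + a) (by linarith)).comp_const_add z a
      exact ((hasDerivAt_firstMoment hk a).sub h1).sub h2
    refine monotoneOn_of_deriv_nonneg (convex_Icc 0 T)
      (fun a ha => (hd a ha.1).continuousAt.continuousWithinAt)
      (fun a ha => (hd a (interior_subset ha).1).differentiableAt.differentiableWithinAt)
      fun a ha => ?_
    have ha' : a ∈ Icc 0 T := interior_subset ha
    rw [(hd a ha'.1).deriv]
    have h3 := h.le_sub (z + a) (z + T) (by linarith [ha'.1]) (by linarith [ha'.2])
      (fun t => k (t - z)) (by fun_prop)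
      (fun t ht => hk0 _ ⟨by linarith [ht.1, ha'.1], by linarith [ht.2]⟩)
      fun t ht σ hσ => hb t ⟨by linarith [ht.1, ha'.1], ht.2⟩ σ hσ
    rw [intervalIntegral.integral_comp_sub_right, add_sub_cancel_left, add_sub_cancel_left,
      hT0, intervalIntegral.integral_symm] at h3
    linarith
  have := hmono ⟨le_rfl, hT⟩ ⟨hT, le_rfl⟩ hT
  simpa [hz0, firstMoment] using this

/-! ### Maxima lie within one delay after a zero -/

/-- Here the sign of the coefficient enters: once the delayed values are positive as well, a
positive solution is convex and cannot rise to a maximum. -/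
theorem peak_le_add_delay (h : IsDelayEvolution α D y y') {z t₁ : ℝ} (hz : α < z)
    (hpos : ∀ t ∈ Icc z t₁, 0 ≤ y t) (hlt : ∀ t ∈ Ico z t₁, y t < y t₁) (h0 : y' t₁ = 0) :
    t₁ ≤ z + D := by
  by_contra! hcon
  have hD := h.delay_nonneg
  have hanti : AntitoneOn y (Icc (z + D) t₁) := by
    refine antitoneOn_of_deriv_nonpos (convex_Icc _ _) (h.continuousOn_Icc (by linarith))
      (fun t ht => ((h.hasDerivAt t (by linarith [(interior_subset ht).1])
        ).differentiableAt.differentiableWithinAt)) fun t ht => ?_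
    have ht' : t ∈ Icc (z + D) t₁ := interior_subset ht
    rw [(h.hasDerivAt t (by linarith [ht'.1])).deriv]
    have := h.le_sub t t₁ (by linarith [ht'.1]) ht'.2 (fun _ => 0) continuous_const
      (fun _ _ => le_rfl) fun s hs σ hσ => neg_nonpos.2
        (hpos σ ⟨by linarith [hσ.1, hs.1, ht'.1], hσ.2.trans hs.2⟩)
    simp only [intervalIntegral.integral_zero, h0] at this
    linarith
  have h1 := hanti ⟨le_rfl, hcon.le⟩ ⟨hcon.le, le_rfl⟩ hcon.le
  exact (hlt (z + D) ⟨by linarith, hcon⟩).not_ge h1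

theorem peak_of_pos (h : IsDelayEvolution α D y y') {u v z t₁ : ℝ} (hu : α < u) (huz : u ≤ z)
    (hzt : z < t₁) (htv : t₁ < v) (hz0 : y z = 0) (hpos : 0 < y t₁)
    (hne : ∀ t ∈ Ioc z t₁, y t ≠ 0) (hmax : ∀ t ∈ Icc u v, |y t| ≤ y t₁)
    (hlt : ∀ t ∈ Ico u t₁, |y t| < y t₁) : y' t₁ = 0 ∧ t₁ ≤ z + D := by
  have hD := h.delay_nonneg
  have h0 : y' t₁ = 0 := by
    refine IsLocalMax.hasDerivAt_eq_zero ?_ (h.hasDerivAt t₁ (by linarith))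
    filter_upwards [Icc_mem_nhds (by linarith : u < t₁) htv] with t ht
    exact (le_abs_self _).trans (hmax t ht)
  refine ⟨h0, h.peak_le_add_delay (hu.trans_le huz) (fun t ht => ?_)
    (fun t ht => (le_abs_self _).trans_lt (hlt t ⟨huz.trans ht.1, ht.2⟩)) h0⟩
  rcases ht.1.eq_or_lt with rfl | hzt'
  · exact hz0.ge
  by_contra! hneg
  obtain ⟨c, hc, hc0⟩ := intermediate_value_Icc ht.2 (h.continuousOn_Icc (by linarith))
    ⟨hneg.le, hpos.le⟩
  exact hne c ⟨hzt'.trans_le hc.1, hc.2⟩ hc0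

/-- Between two zeros, `|y|` has a first maximum `t₁`, which is preceded by a last zero `z` within
the delay. After a change of sign, the maximum is positive. -/
theorem exists_peak (h : IsDelayEvolution α D y y') {u v t₂ : ℝ} (hu : α < u) (hut : u ≤ t₂)
    (htv : t₂ ≤ v) (hu0 : y u = 0) (hv0 : y v = 0) (ht₂ : y t₂ ≠ 0) :
    ∃ (w w' : ℝ → ℝ) (z T : ℝ), IsDelayEvolution α D w w' ∧ (∀ t, |w t| = |y t|) ∧ u ≤ z ∧
      0 < T ∧ T ≤ D ∧ w z = 0 ∧ w' (z + T) = 0 ∧ |y t₂| ≤ w (z + T) ∧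
      ∀ t ∈ Ico u (z + T), |w t| < w (z + T) := by
  have hD := h.delay_nonneg
  have hc : ContinuousOn (fun t => |y t|) (Icc u v) := (h.continuousOn_Icc (by linarith)).abs
  obtain ⟨m, hm, hmax⟩ := isCompact_Icc.exists_isMaxOn ⟨t₂, hut, htv⟩ hc
  have hm0 : 0 < |y m| := (abs_pos.2 ht₂).trans_le (hmax ⟨hut, htv⟩)
  have hS : IsCompact (Icc u v ∩ (fun t => |y t|) ⁻¹' {|y m|}) :=
    isCompact_Icc.of_isClosed_subset
      (hc.preimage_isClosed_of_isClosed isClosed_Icc isClosed_singleton) inter_subset_left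
  obtain ⟨t₁, ⟨ht₁, ht₁m⟩, hleast⟩ := hS.exists_isLeast ⟨m, hm, rfl⟩
  simp only [mem_preimage, mem_singleton_iff] at ht₁m
  have ht₁0 : y t₁ ≠ 0 := abs_pos.1 (ht₁m ▸ hm0)
  have hmax' : ∀ t ∈ Icc u v, |y t| ≤ |y t₁| := fun t ht => (hmax ht).trans_eq ht₁m.symm
  have hlt : ∀ t ∈ Ico u t₁, |y t| < |y t₁| := fun t ht =>
    lt_of_le_of_ne (hmax' t ⟨ht.1, ht.2.le.trans ht₁.2⟩) fun heq =>
      ht.2.not_ge (hleast ⟨⟨ht.1, ht.2.le.trans ht₁.2⟩, heq.trans ht₁m⟩)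
  have htv₁ : t₁ < v := lt_of_le_of_ne ht₁.2 (by rintro rfl; exact ht₁0 hv0)
  have hZ : IsCompact (Icc u t₁ ∩ y ⁻¹' {0}) :=
    isCompact_Icc.of_isClosed_subset
      ((h.continuousOn_Icc (by linarith)).preimage_isClosed_of_isClosed isClosed_Icc
        isClosed_singleton) inter_subset_left
  obtain ⟨z, ⟨hz, hz0⟩, hgreat⟩ := hZ.exists_isGreatest ⟨u, ⟨le_rfl, ht₁.1⟩, hu0⟩
  simp only [mem_preimage, mem_singleton_iff] at hz0
  have hzt : z < t₁ := lt_of_le_of_ne hz.2 (by rintro rfl; exact ht₁0 hz0)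
  have hne : ∀ t ∈ Ioc z t₁, y t ≠ 0 := fun t ht h0 =>
    ht.1.not_ge (hgreat ⟨⟨hz.1.trans ht.1.le, ht.2⟩, h0⟩)
  rcases ht₁0.lt_or_gt with hneg | hpos
  · rw [abs_of_neg hneg] at hmax' hlt
    have hp := h.neg.peak_of_pos hu hz.1 hzt htv₁ (by simp [hz0]) (by simpa using hneg)
      (by simpa using hne) (by simpa using hmax') (by simpa using hlt)
    refine ⟨fun t => -y t, fun t => -y' t, z, t₁ - z, h.neg, fun t => abs_neg _, hz.1,
      by linarith, by linarith [hp.2], by simp [hz0], ?_⟩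
    rw [add_sub_cancel]
    exact ⟨hp.1, hmax' t₂ ⟨hut, htv⟩, by simpa using hlt⟩
  · rw [abs_of_pos hpos] at hmax' hlt
    have hp := h.peak_of_pos hu hz.1 hzt htv₁ hz0 hpos hne hmax' hlt
    refine ⟨y, y', z, t₁ - z, h, fun t => rfl, hz.1, by linarith, by linarith [hp.2], hz0, ?_⟩
    rw [add_sub_cancel]
    exact ⟨hp.1, hmax' t₂ ⟨hut, htv⟩, hlt⟩

end IsDelayEvolution

/-! ### Boundedness and decay of oscillatory solutions -/

/-- If in the window before a zero the delayed values are bounded by `ρ < 1` as well, the forcing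
`g_n` is reduced by an amount with positive first moment that does not depend on `n`. -/
theorem exists_firstMoment_lt {γ ρ : ℝ} (hγ : √2 ≤ γ) (hfix : Psi 1 γ = γ) (hρ0 : 0 ≤ ρ)
    (hρ : ρ < 1) : ∃ n : ℕ,
      firstMoment (fun a => max (riseSeq γ n a) (min (delayProfile γ a) ρ)) γ < 1 := by
  have hγ0 : 0 < γ := lt_of_lt_of_le (by positivity) hγ
  set φ : ℝ → ℝ := fun a => max (delayProfile γ a - max (2 * a) ρ) 0 with hφ
  have hp := continuous_delayProfile γ
  have hφc : Continuous φ := by rw [hφ]; fun_prop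
  have hφpos : 0 < firstMoment φ γ := by
    refine intervalIntegral.integral_pos hγ0 (Continuous.continuousOn (by fun_prop))
      (fun w hw => mul_nonneg hw.1.le (le_max_right _ _)) ⟨(1 - ρ) / 4, ⟨by linarith, ?_⟩, ?_⟩
    · have : (1 : ℝ) ≤ √2 := Real.one_le_sqrt.2 one_le_two
      linarith
    · refine mul_pos (by linarith) (lt_of_lt_of_le ?_ (le_max_left _ _))
      have h1 : max ((1 - ρ) / 4 - (γ - √2)) 0 ≤ (1 - ρ) / 4 := max_le (by linarith) (by linarith)
      have h2 := pow_le_pow_left₀ (le_max_right _ _) h1 2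
      rw [sub_pos, delayProfile]
      refine max_lt ?_ ?_ <;> nlinarith
  have hlim := tendsto_riseTimeSeq hγ
  rw [hfix] at hlim
  obtain ⟨n, hn⟩ := ((hlim.comp (tendsto_add_atTop_nat 1)).eventually
    (lt_mem_nhds (show γ - firstMoment φ γ / γ < γ by
      have := div_pos hφpos hγ0
      linarith))).exists
  have hn : γ - firstMoment φ γ / γ < riseTimeSeq γ (n + 1) := hn
  refine ⟨n + 1, ?_⟩
  have hA := admissible_riseForcing γ (n + 1)
  have hB := (admissible_riseSeq γ (n + 1)).cont
  have hc := hA.cont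
  have hT : riseTimeSeq γ (n + 1) ≤ γ := (riseTimeSeq_le_Psi hγ _).trans_eq hfix
  have hT0 : 0 < riseTimeSeq γ (n + 1) := hA.riseTime_pos
  have e1 : firstMoment (fun a => max (riseSeq γ (n + 1) a) (min (delayProfile γ a) ρ)) γ ≤
      firstMoment (riseForcing γ (n + 1)) γ - firstMoment φ γ := by
    rw [firstMoment, firstMoment, firstMoment, ← intervalIntegral.integral_sub
      (Continuous.intervalIntegrable (by fun_prop) _ _)
      (Continuous.intervalIntegrable (by fun_prop) _ _)]
    refine intervalIntegral.integral_mono_on hγ0.le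
      (Continuous.intervalIntegrable (by fun_prop) _ _)
      (Continuous.intervalIntegrable (by fun_prop) _ _) fun w hw => ?_
    rw [← mul_sub]
    refine mul_le_mul_of_nonneg_left ?_ hw.1
    have hb : riseSeq γ (n + 1) w ≤ 2 * w := (admissible_riseForcing γ n).rise_le_two_mul hw.1
    have h2 := le_max_left (2 * w) ρ
    have h3 := le_max_right (2 * w) ρ
    simp only [hφ, riseForcing]
    rcases le_total (delayProfile γ w - max (2 * w) ρ) 0 with h | h
    · rw [max_eq_right h, sub_zero]
      exact max_le_max_left _ (min_le_left _ _)
    · rw [max_eq_left h]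
      rw [max_eq_right (by linarith : riseSeq γ (n + 1) w ≤ delayProfile γ w), sub_sub_cancel]
      exact max_le (hb.trans h2) ((min_le_right _ _).trans h3)
  have e2 : firstMoment (riseForcing γ (n + 1)) γ - 1 ≤ γ * (γ - riseTimeSeq γ (n + 1)) := by
    have hs := firstMoment_sub hc (riseTimeSeq γ (n + 1)) γ
    have h1 : firstMoment (riseForcing γ (n + 1)) (riseTimeSeq γ (n + 1)) = 1 :=
      hA.riseTime_spec.2
    rw [h1] at hs
    rw [hs]
    have : ∫ w in riseTimeSeq γ (n + 1)..γ, w * riseForcing γ (n + 1) w ≤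
        ∫ _ in riseTimeSeq γ (n + 1)..γ, γ := by
      refine intervalIntegral.integral_mono_on hT
        (Continuous.intervalIntegrable (by fun_prop) _ _)
        (Continuous.intervalIntegrable (by fun_prop) _ _) fun w hw => ?_
      have hw0 : 0 ≤ w := hT0.le.trans hw.1
      exact (mul_le_of_le_one_right hw0 (hA.le_one w hw0)).trans hw.2
    rw [intervalIntegral.integral_const, smul_eq_mul] at this
    linarith
  have e3 : γ * (γ - riseTimeSeq γ (n + 1)) < firstMoment φ γ := by
    have : γ - riseTimeSeq γ (n + 1) < firstMoment φ γ / γ := by linarith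
    rwa [lt_div_iff₀' hγ0] at this
  linarith

namespace IsDelayEvolution

variable {α D : ℝ} {y y' : ℝ → ℝ}

/-- A new strict record of `|y|` is impossible if the delay is at most the fixed point `γ`. The
maximum `1` requires the times `ϖ_n`, hence the time `γ`, after a zero, but lies within the delay.
So the time is exactly `γ`, for which the strictly smaller values before the zero do not suffice. -/
theorem record_false (h : IsDelayEvolution α D y y') {γ z T : ℝ} (hγ : √2 ≤ γ)
    (hfix : Psi 1 γ = γ) (hDγ : D ≤ γ) (hz : α + √2 < z) (hT0 : 0 < T) (hTD : T ≤ D)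
    (hz0 : y z = 0) (hT' : y' (z + T) = 0) (hyT : y (z + T) = 1)
    (hlt : ∀ t ∈ Ico (α - D) (z + T), |y t| < 1) : False := by
  have h0 := Real.sqrt_nonneg 2
  have hD := h.delay_nonneg
  have hb : ∀ t ∈ Icc (α - D) (z + T), |y t| ≤ 1 := by
    intro t ht
    rcases ht.2.eq_or_lt with rfl | h2
    · simp [hyT]
    · exact (hlt t ⟨ht.1, h2⟩).le
  have step : ∀ n, (∀ a ∈ Icc 0 T, |y (z + a)| ≤ riseSeq γ n a) → riseTimeSeq γ n ≤ T := by
    intro n hn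
    have hA := admissible_riseForcing γ n
    have h1 := h.le_firstMoment (by linarith) hT0.le hz0 hT' hA.cont
      (fun a ha => hA.nonneg ha.1) fun t ht σ hσ => (neg_le_abs _).trans
        (h.abs_le_riseForcing hDγ hz hz0 hb hn ht hσ)
    rw [hyT, ← hA.riseTime_spec.2] at h1
    exact (hA.firstMoment_strictMonoOn.le_iff_le hA.riseTime_pos.le hT0.le).1 h1
  have all : ∀ n, ∀ a ∈ Icc 0 T, |y (z + a)| ≤ riseSeq γ n a := by
    intro n
    induction n with
    | zero => exact abs_le_riseSeq_zero (by linarith) hb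
    | succ n ih => exact h.abs_le_riseSeq_succ hDγ hz hz0 hb ih (step n ih)
  have hTγ : T = γ := by
    refine le_antisymm (hTD.trans hDγ) ?_
    rw [← hfix]
    exact le_of_tendsto' (tendsto_riseTimeSeq hγ) fun n => step n (all n)
  obtain ⟨m, hm, hmax⟩ := (isCompact_Icc (a := α - D) (b := z)).exists_isMaxOn
    ⟨z, by linarith, le_rfl⟩ (h.continuousOn_Icc le_rfl).abs
  obtain ⟨n, hn⟩ := exists_firstMoment_lt hγ hfix (abs_nonneg (y m))
    (hlt m ⟨hm.1, by linarith [hm.2]⟩)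
  have hA := admissible_riseSeq γ n
  have hB := hA.cont
  have hC := continuous_delayProfile γ
  have h1 := h.le_firstMoment
    (k := fun a => max (riseSeq γ n a) (min (delayProfile γ a) |y m|))
    (by linarith) hT0.le hz0 hT' (by fun_prop)
    (fun a ha => (hA.nonneg ha.1).trans (le_max_left _ _)) fun t ht σ hσ => by
      refine (neg_le_abs _).trans ?_
      rcases h.abs_le_max hDγ hz hz0 hb (all n) ht hσ with h2 | h2
      · exact h2.2.trans (le_max_left _ _)
      · exact (le_min h2.2 (hmax ⟨by linarith [hσ.1, ht.1], h2.1⟩)).trans (le_max_right _ _)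
  rw [hyT, hTγ] at h1
  exact hn.not_ge h1

theorem exists_bound (h : IsDelayEvolution α D y y') {γ : ℝ} (hγ : √2 ≤ γ)
    (hfix : Psi 1 γ = γ) (hDγ : D ≤ γ) (hosc : IsOscillatory y) :
    ∃ C : ℝ, ∀ t ≥ α - D, |y t| ≤ C := by
  have h0 := Real.sqrt_nonneg 2
  have hD := h.delay_nonneg
  obtain ⟨u, hu, hu0⟩ := hosc (α + √2)
  obtain ⟨K, hK⟩ := (isCompact_Icc (a := α - D) (b := u)).exists_bound_of_continuousOn
    (h.continuousOn_Icc le_rfl)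
  simp only [Real.norm_eq_abs] at hK
  refine ⟨K, fun t₂ ht₂ => ?_⟩
  by_contra! hlt
  have hut : u < t₂ := by
    by_contra! hle
    exact (hK t₂ ⟨ht₂, hle⟩).not_gt hlt
  have hK0 : 0 ≤ K := (abs_nonneg _).trans (hK u ⟨by linarith, le_rfl⟩)
  obtain ⟨v, hv, hv0⟩ := hosc t₂
  obtain ⟨w, w', z, T, hw, hwy, huz, hT0, hTD, hz0, hT', hrec, hbelow⟩ :=
    h.exists_peak (by linarith) hut.le hv.le hu0 hv0 (abs_pos.1 (hK0.trans_lt hlt))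
  set N := w (z + T) with hN
  have hKN : K < N := hlt.trans_le hrec
  have hN0 : 0 < N := hK0.trans_lt hKN
  refine (hw.const_mul (inv_pos.2 hN0)).record_false hγ hfix hDγ (hu.trans_le huz) hT0 hTD
    (by simp [hz0]) (by simp [hT']) (inv_mul_cancel₀ hN0.ne') fun t ht => ?_
  rw [abs_mul, abs_of_pos (inv_pos.2 hN0), inv_mul_lt_one₀ hN0]
  rcases le_total u t with hle | hle
  · exact hbelow t ⟨hle, ht.2⟩
  · rw [hwy]
    exact (hK t ⟨ht.1, hle⟩).trans_lt hKN

/-- If `|y| ≤ M` from some time on, the maxima after a zero are at most the first moment of `g_n`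
over the delay times `M`. -/
theorem eventually_le_mul (h : IsDelayEvolution α D y y') {γ : ℝ} (hγ : √2 ≤ γ)
    (hfix : Psi 1 γ = γ) (hDγ : D ≤ γ) (hosc : IsOscillatory y) (n : ℕ) {M : ℝ} (hM : 0 < M)
    (hy : ∀ᶠ t in atTop, |y t| ≤ M) :
    ∀ᶠ t in atTop, |y t| ≤ firstMoment (riseForcing γ n) D * M := by
  have h0 := Real.sqrt_nonneg 2
  have hD := h.delay_nonneg
  have hA := admissible_riseForcing γ n
  obtain ⟨t₀, ht₀⟩ := eventually_atTop.1 hy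
  set α' := max α (t₀ + D) with hα'
  have h' := h.mono_start (le_max_left α (t₀ + D))
  have hb : ∀ t ≥ α' - D, |y t| ≤ M := fun t ht =>
    ht₀ t (by linarith [le_max_right α (t₀ + D)])
  have hκ0 : 0 ≤ firstMoment (riseForcing γ n) D :=
    intervalIntegral.integral_nonneg hD fun w hw => mul_nonneg hw.1 (hA.nonneg hw.1)
  obtain ⟨u, hu, hu0⟩ := hosc (α' + √2)
  refine eventually_atTop.2 ⟨u, fun t₂ ht₂ => ?_⟩
  by_contra! hlt
  obtain ⟨v, hv, hv0⟩ := hosc t₂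
  obtain ⟨w, w', z, T, hw, hwy, huz, hT0, hTD, hz0, hT', hrec, -⟩ :=
    h'.exists_peak (by linarith) ht₂ hv.le hu0 hv0
      (abs_pos.1 ((mul_nonneg hκ0 hM.le).trans_lt hlt))
  have hw₁ := hw.const_mul (inv_pos.2 hM)
  have hz : α' + √2 < z := hu.trans_le huz
  have hz1 : M⁻¹ * w z = 0 := by simp [hz0]
  have hb₁ : ∀ t ∈ Icc (α' - D) (z + γ), |M⁻¹ * w t| ≤ 1 := fun t ht => by
    rw [abs_mul, abs_of_pos (inv_pos.2 hM), inv_mul_le_one₀ hM, hwy]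
    exact hb t ht.1
  have all : ∀ m, ∀ a ∈ Icc 0 γ, |M⁻¹ * w (z + a)| ≤ riseSeq γ m a := by
    intro m
    induction m with
    | zero => exact abs_le_riseSeq_zero (y := fun t => M⁻¹ * w t) (by linarith) hb₁
    | succ m ih =>
      exact hw₁.abs_le_riseSeq_succ hDγ hz hz1 hb₁ ih ((riseTimeSeq_le_Psi hγ m).trans_eq hfix)
  have h1 := hw₁.le_firstMoment (by linarith) hT0.le hz1 (by simp [hT']) hA.cont
    (fun a ha => hA.nonneg ha.1) fun t ht σ hσ => (neg_le_abs _).trans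
      (hw₁.abs_le_riseForcing hDγ hz hz1 hb₁ (all n) ⟨ht.1, by linarith [ht.2]⟩ hσ)
  have h2 := h1.trans (hA.firstMoment_strictMonoOn.monotoneOn hT0.le hD hTD)
  rw [inv_mul_le_iff₀ hM] at h2
  linarith

theorem tendsto_zero (h : IsDelayEvolution α D y y') {γ : ℝ} (hγ : √2 ≤ γ)
    (hfix : Psi 1 γ = γ) (hDγ : D < γ) (hosc : IsOscillatory y) : Tendsto y atTop (𝓝 0) := by
  have hD := h.delay_nonneg
  obtain ⟨C, hC⟩ := h.exists_bound hγ hfix hDγ.le hosc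
  have hlim := tendsto_riseTimeSeq hγ
  rw [hfix] at hlim
  obtain ⟨n, hn⟩ := (hlim.eventually (lt_mem_nhds hDγ)).exists
  have hA := admissible_riseForcing γ n
  have hκ : firstMoment (riseForcing γ n) D < 1 := by
    rw [← hA.riseTime_spec.2]
    exact hA.firstMoment_strictMonoOn hD hA.riseTime_pos.le hn
  set q := max (firstMoment (riseForcing γ n) D) (1 / 2) with hq
  have hq0 : 0 < q := lt_of_lt_of_le (by norm_num) (le_max_right _ _)
  have hq1 : q < 1 := max_lt hκ (by norm_num)
  have hC0 : 0 < max C 1 := lt_of_lt_of_le one_pos (le_max_right _ _)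
  have hm : ∀ m : ℕ, ∀ᶠ t in atTop, |y t| ≤ q ^ m * max C 1 := by
    intro m
    induction m with
    | zero =>
      filter_upwards [eventually_ge_atTop (α - D)] with t ht
      simpa using Or.inl (hC t ht)
    | succ m ih =>
      have hpos : 0 < q ^ m * max C 1 := by positivity
      filter_upwards [h.eventually_le_mul hγ hfix hDγ.le hosc n hpos ih] with t ht
      refine ht.trans ?_
      rw [pow_succ', mul_assoc]
      exact mul_le_mul_of_nonneg_right (le_max_left _ _) hpos.le
  rw [Metric.tendsto_nhds]
  intro ε hε
  have hlim' : Tendsto (fun m : ℕ => q ^ m * max C 1) atTop (𝓝 0) := by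
    simpa using (tendsto_pow_atTop_nhds_zero_of_lt_one hq0.le hq1).mul_const (max C 1)
  obtain ⟨m, hmε⟩ := (hlim'.eventually (gt_mem_nhds hε)).exists
  filter_upwards [hm m] with t ht
  rw [Real.dist_eq, sub_zero]
  exact ht.trans_lt hmε

end IsDelayEvolution

/-! ### Solutions in the sense of Carathéodory -/

theorem ae_le_maxDelay {τ : ℝ → ℝ} (hτ : IsEssBdd τ) (s : ℝ) :
    ∀ᵐ t ∂(volume.restrict (Ici s)), τ t ≤ maxDelay τ s := by
  obtain ⟨-, C, hC⟩ := hτ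
  refine ae_le_essSup ⟨C, ?_⟩
  rw [eventually_map]
  filter_upwards [ae_restrict_of_ae hC] with t ht
  exact (le_abs_self _).trans ht

theorem maxDelay_nonneg {τ : ℝ → ℝ} (hτ : IsEssBdd τ) (h0 : ∀ t, 0 ≤ τ t) (s : ℝ) :
    0 ≤ maxDelay τ s := by
  have : (ae (volume.restrict (Ici s))).NeBot := by
    rw [ae_neBot, Ne, Measure.restrict_eq_zero]
    simp
  obtain ⟨t, ht⟩ := (ae_le_maxDelay hτ s).exists
  exact (h0 t).trans ht

theorem ae_abs_le_essSup {p : ℝ → ℝ} (hp : IsEssBdd p) :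
    ∀ᵐ t, |p t| ≤ essSup (fun t => |p t|) volume := by
  obtain ⟨-, C, hC⟩ := hp
  exact ae_le_essSup ⟨C, by rwa [eventually_map]⟩

section Integrated

variable {p τ x x' : ℝ → ℝ} {s P d : ℝ}

/-- The increments of the derivative of a solution, from the fundamental theorem of calculus for
absolutely continuous functions. -/
theorem deriv_sub_le (hpP : ∀ᵐ t, |p t| ≤ P) (hp : ∀ t, p t ≤ 0)
    (hτd : ∀ᵐ t ∂(volume.restrict (Ici s)), τ t ≤ d) (hτ : ∀ t, 0 ≤ τ t)
    (hx : ∀ᵐ t ∂(volume.restrict (Ici s)), ∃ x'' : ℝ,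
      HasDerivAt x' x'' t ∧ x'' + p t * x (t - τ t) = 0) {a b : ℝ} (ha : s ≤ a) (hab : a ≤ b)
    (hac : AbsolutelyContinuousOnInterval x' a b) {g : ℝ → ℝ} (hg : Continuous g)
    (hg0 : ∀ t ∈ Icc a b, 0 ≤ g t) (hxg : ∀ t ∈ Icc a b, ∀ σ ∈ Icc (t - d) t, x σ ≤ g t) :
    x' b - x' a ≤ P * ∫ t in a..b, g t := by
  have hsub : Icc a b ⊆ Ici s := fun t ht => ha.trans ht.1
  rw [← hac.integral_deriv_eq_sub, ← intervalIntegral.integral_const_mul]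
  refine intervalIntegral.integral_mono_ae_restrict hab hac.intervalIntegrable_deriv
    (Continuous.intervalIntegrable (by fun_prop) _ _) ?_
  filter_upwards [ae_restrict_of_ae_restrict_of_subset hsub hτd,
    ae_restrict_of_ae_restrict_of_subset hsub hx, ae_restrict_of_ae hpP,
    ae_restrict_mem measurableSet_Icc] with t h1 h2 h3 ht
  obtain ⟨x'', hd, he⟩ := h2
  rw [hd.deriv]
  have h4 := hxg t ht (t - τ t) ⟨by linarith, by linarith [hτ t]⟩
  have h5 := abs_le.1 h3
  have h6 : 0 ≤ -p t := by linarith [hp t]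
  calc x'' = -p t * x (t - τ t) := by linarith
    _ ≤ -p t * g t := mul_le_mul_of_nonneg_left h4 h6
    _ ≤ P * g t := mul_le_mul_of_nonneg_right (by linarith) (hg0 t ht)

/-- Measuring time in units of `1 / √P` turns the bound `P` for the coefficient into `1`. -/
theorem isDelayEvolution_of_isSolution (hP : 0 < P) (hpP : ∀ᵐ t, |p t| ≤ P) (hp : ∀ t, p t ≤ 0)
    (hτb : IsEssBdd τ) (hτ : ∀ t, 0 ≤ τ t) (hx : IsSolution p τ s x) :
    ∃ y', IsDelayEvolution (s * √P) (maxDelay τ s * √P) (fun t => x (t / √P)) y' := by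
  obtain ⟨x', hd, hac, heq⟩ := hx
  have hk : 0 < √P := Real.sqrt_pos.2 hP
  have hkk : √P * √P = P := Real.mul_self_sqrt hP.le
  have hd0 := maxDelay_nonneg hτb hτ s
  have hτd := ae_le_maxDelay hτb s
  have key : ∀ {ξ ξ' : ℝ → ℝ}, (∀ᵐ t ∂(volume.restrict (Ici s)), ∃ x'' : ℝ,
      HasDerivAt ξ' x'' t ∧ x'' + p t * ξ (t - τ t) = 0) →
      (∀ T ≥ s - maxDelay τ s, AbsolutelyContinuousOnInterval ξ' (s - maxDelay τ s) T) →
      ∀ a b, s * √P ≤ a → a ≤ b → ∀ g : ℝ → ℝ, Continuous g → (∀ t ∈ Icc a b, 0 ≤ g t) →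
      (∀ t ∈ Icc a b, ∀ σ ∈ Icc (t - maxDelay τ s * √P) t, ξ (σ / √P) ≤ g t) →
      ξ' (b / √P) / √P - ξ' (a / √P) / √P ≤ ∫ t in a..b, g t := by
    intro ξ ξ' hξ hξac a b ha hab g hg hg0 hξg
    have ha' : s ≤ a / √P := (le_div_iff₀ hk).2 ha
    have hab' : a / √P ≤ b / √P := div_le_div_of_nonneg_right hab hk.le
    have h1 := deriv_sub_le hpP hp hτd hτ hξ ha' hab'
      ((hξac (b / √P) (by linarith)).mono (by
        rw [uIcc_of_le hab', uIcc_of_le (by linarith)]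
        exact Icc_subset_Icc_left (by linarith)))
      (g := fun t => g (√P * t)) (by fun_prop)
      (fun t ht => hg0 _ ⟨by rw [← div_le_iff₀' hk]; exact ht.1,
        by rw [← le_div_iff₀' hk]; exact ht.2⟩)
      (fun t ht σ hσ => by
        have := hξg (√P * t) ⟨by rw [← div_le_iff₀' hk]; exact ht.1,
          by rw [← le_div_iff₀' hk]; exact ht.2⟩ (√P * σ) ⟨by nlinarith [hσ.1],
            mul_le_mul_of_nonneg_left hσ.2 hk.le⟩
        rwa [mul_div_cancel_left₀ _ hk.ne'] at this)
    rw [intervalIntegral.integral_comp_mul_left _ hk.ne', mul_div_cancel₀ _ hk.ne',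
      mul_div_cancel₀ _ hk.ne', smul_eq_mul] at h1
    rw [← sub_div, div_le_iff₀ hk]
    refine h1.trans_eq ?_
    nth_rewrite 1 [← hkk]
    field_simp
  refine ⟨fun t => x' (t / √P) / √P, mul_nonneg hd0 hk.le, ?_, fun t ht => ?_,
    key heq fun T hT => (hac T hT).2, ?_⟩
  · have hcx : ContinuousOn x (Ici (s - maxDelay τ s)) := fun t ht =>
      (hd t ht).continuousWithinAt
    refine hcx.comp (by fun_prop) fun t ht => ?_
    rw [mem_Ici, le_div_iff₀ hk, sub_mul]
    exact ht
  · have ht' : s < t / √P := (lt_div_iff₀ hk).2 ht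
    have h1 := (hd (t / √P) (by linarith)).hasDerivAt (Ici_mem_nhds (by linarith))
    have h2 := h1.comp t ((hasDerivAt_id t).div_const (√P))
    refine h2.congr_deriv ?_
    ring
  · intro a b ha hab g hg hg0 hxg
    have := key (ξ := fun t => -x t) (ξ' := fun t => -x' t) (by
      filter_upwards [heq] with t ht
      obtain ⟨x'', h1, h2⟩ := ht
      exact ⟨-x'', h1.neg, by linarith⟩) (fun T hT => (hac T hT).2.neg) a b ha hab g hg hg0 hxg
    simp only [neg_div] at this
    linarith

end Integrated

/-- A positive bound for the coefficient can be chosen that keeps a strict bound for the delay, also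
if the coefficient vanishes almost everywhere. -/
theorem exists_pos_le_sqrt {d E γ : ℝ} (hγ : 0 < γ) (hE : 0 ≤ E) :
    ∃ P, 0 < P ∧ E ≤ P ∧ (d * √E ≤ γ → d * √P ≤ γ) ∧ (d * √E < γ → d * √P < γ) := by
  rcases hE.eq_or_lt with rfl | hpos
  · have hlim : Tendsto (fun P => d * √P) (𝓝[>] 0) (𝓝 (d * √0)) :=
      (Continuous.tendsto (by fun_prop) 0).mono_left nhdsWithin_le_nhds
    rw [Real.sqrt_zero, mul_zero] at hlim
    obtain ⟨P, hP, hP0⟩ := ((hlim.eventually (gt_mem_nhds hγ)).and self_mem_nhdsWithin).exists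
    exact ⟨P, hP0, le_of_lt hP0, fun _ => hP.le, fun _ => hP⟩
  · exact ⟨E, hpos, le_rfl, id, id⟩

end DelayEq

end

open DelayEq in
theorem theorem3p14 :
    (∃! γ : ℝ, γ ∈ Set.Icc (√2) (Real.pi / 2) ∧ DelayEq.Psi 1 γ = γ) ∧
    ∀ γ : ℝ, γ ∈ Set.Icc (√2) (Real.pi / 2) → DelayEq.Psi 1 γ = γ →
    ∀ (p τ : ℝ → ℝ), DelayEq.IsEssBdd p → DelayEq.IsEssBdd τ →
      (∀ t, p t ≤ 0) → (∀ t, 0 ≤ τ t) →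
    ∀ (s : ℝ) (x : ℝ → ℝ), DelayEq.IsSolution p τ s x → DelayEq.IsOscillatory x →
      (DelayEq.maxDelay τ s * √(essSup (fun t => |p t|) volume) ≤ γ →
        ∃ C : ℝ, ∀ t ≥ s - DelayEq.maxDelay τ s, |x t| ≤ C) ∧
      (DelayEq.maxDelay τ s * √(essSup (fun t => |p t|) volume) < γ →
        Tendsto x atTop (𝓝 0)) := by
  refine ⟨existsUnique_fix, ?_⟩
  intro γ hγ hfix p τ hpb hτb hp hτ s x hx hosc
  have hγ0 : 0 < γ := lt_of_lt_of_le (by positivity) hγ.1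
  have hpE := ae_abs_le_essSup hpb
  have hE : 0 ≤ essSup (fun t => |p t|) volume := by
    obtain ⟨t, ht⟩ := hpE.exists
    exact (abs_nonneg _).trans ht
  obtain ⟨P, hP, hEP, hle, hlt⟩ := exists_pos_le_sqrt (d := maxDelay τ s) hγ0 hE
  have hk : 0 < √P := Real.sqrt_pos.2 hP
  obtain ⟨y', hy⟩ := isDelayEvolution_of_isSolution hP (hpE.mono fun t ht => ht.trans hEP) hp
    hτb hτ hx
  have hosc' : IsOscillatory fun t => x (t / √P) := by
    intro T
    obtain ⟨t, ht, h0⟩ := hosc (T / √P)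
    exact ⟨t * √P, (div_lt_iff₀ hk).1 ht, by simpa [mul_div_cancel_right₀ _ hk.ne'] using h0⟩
  constructor
  · intro hcon
    obtain ⟨C, hC⟩ := hy.exists_bound hγ.1 hfix (hle hcon) hosc'
    refine ⟨C, fun t ht => ?_⟩
    have : |x (t * √P / √P)| ≤ C := hC (t * √P) (by
      rw [← sub_mul]
      exact mul_le_mul_of_nonneg_right ht hk.le)
    rwa [mul_div_cancel_right₀ _ hk.ne'] at this
  · intro hcon
    have h1 := hy.tendsto_zero hγ.1 hfix (hlt hcon) hosc'
    have h2 := h1.comp (tendsto_id.atTop_mul_const hk)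
    refine h2.congr fun t => ?_
    simp [mul_div_cancel_right₀ _ hk.ne']
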